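/- Let $v$ be an indeterminate, $\mathcal Z=\mathbb Z[v,v^{-1}]\subset\mathbb Q(v)$, and for $N\in\mathbb Z$, $t\in\mathbb N$ put $[N]=\frac{v^N-v^{-N}}{v-v^{-1}}$ and $\left[{N\atop t}\right]=\frac{[N][N-1]\cdots[N-t+1]}{[1][2]\cdots[t]}$. For $\mu\in\mathbb Z^n$, $\lambda\in\mathbb N^n$ let $\left[{\mu\atop\lambda}\right]=\prod_{i}\left[{\mu_i\atop\lambda_i}\right]$. For $r\ge 0$ let $\mathcal H(r)$ be the Hecke algebra of the symmetric group $\mathfrak S_r$ over $\mathbb Q(v)$, generated by $T_1,\dots,T_{r-1}$ with $(T_i+1)(T_i-v^2)=0$, $T_iT_{i+1}T_i=T_{i+1}T_iT_{i+1}$ and $T_iT_j=T_jT_i$ for $|i-j|>1$; let $T_w=T_{i_1}\cdots T_{i_m}$ for a reduced expression $w=s_{i_1}\cdots s_{i_m}$, $s_i=(i,i+1)$. Let $\Lambda(n,r)$ be the set of $\lambda\in\mathbb N^n$ with $\sum_i\lambda_i=r$. For $\lambda\in\Lambda(n,r)$ let $R^\lambda_1,\dots,R^\lambda_n$ be the consecutive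 blocks of sizes $\lambda_1,\dots,\lambda_n$ in $\{1,\dots,r\}$, $\mathfrak S_\lambda$ the Young subgroup of permutations preserving these blocks, and $x_\lambda=\sum_{w\in\mathfrak S_\lambda}T_w$. The $q$-Schur algebra is $$\boldsymbol{\mathcal S}(n,r)=\operatorname{End}_{\mathcal H(r)}\Big(\bigoplus_{\lambda\in\Lambda(n,r)}x_\lambda\mathcal H(r)\Big),$$ the endomorphism algebra of a right $\mathcal H(r)$-module. For $\lambda,\mu\in\Lambda(n,r)$ and a distinguished (that is, minimal length) $(\mathfrak S_\lambda,\mathfrak S_\mu)$ double coset representative $d$, let $\phi^d_{\lambda\mu}\in\boldsymbol{\mathcal S}(n,r)$ be given by $\phi^d_{\lambda\mu}(x_\nu h)=\delta_{\mu,\nu}\sum_{x\in\mathfrak S_\lambda d\,\mathfrak S_\mu}T_xh$. For an $n\times n$ matrix $A=(a_{i,j})$ over $\mathbb N$ with sum of entries $\sigma(A)=r$, let $$[A]=v^{-d_A}\phi^d_{\lambda\mu},\qquad d_A=\sum_{i\ge k,\ j<l}a_{i,j}a_{k,l},$$ where $\lambda$ and $\mu$ are the vectors of row sums and of column sums of $A$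 and $d$ is the distinguished representative with $a_{k,l}=|R^\lambda_k\cap dR^\mu_l|$ for all $k,l$. Let $\Theta^\pm(n)$ be the set of $n\times n$ matrices over $\mathbb N$ with zero diagonal. For $A\in\Theta^\pm(n)$, $\delta\in\mathbb Z^n$, $\lambda\in\mathbb N^n$ let $$A(\delta,\lambda)=\Big(\sum_{\mu\in\Lambda(n,r-\sigma(A))}v^{\sum_i\mu_i\delta_i}\left[{\mu\atop\lambda}\right][A+\operatorname{diag}(\mu)]\Big)_{r\ge0}\in\prod_{r\ge0}\boldsymbol{\mathcal S}(n,r),$$ the sum being empty when $r<\sigma(A)$, and let $A(\mathbf 0)=A(\mathbf 0,\mathbf 0)$; the elements $0(\delta,\lambda)$ are those for the zero matrix $A=0$. Let $\mathcal V(n)$ be the $\mathcal Z$-submodule of $\prod_{r\ge0}\boldsymbol{\mathcal S}(n,r)$ spanned by all $A(\delta,\lambda)$ with $A\in\Theta^\pm(n)$, $\delta\in\mathbb Z^n$, $\lambda\in\mathbb N^n$. **Lemma.** Each of the following three families, indexed by all triples $(A,\delta,\lambda)$ with $A\in\Theta^\pm(n)$, $\delta,\lambda\in\mathbb N^n$ and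 $\delta_i\in\{0,1\}$ for all $i$, is a $\mathcal Z$-basis of $\mathcal V(n)$: (1) $0(\delta,\lambda)\,A(\mathbf 0)$; (2) $A(\mathbf 0)\,0(\delta,\lambda)$; (3) $A(\delta,\lambda)$. -/

import Mathlib

noncomputable section

namespace BLM

/-! ### The ground rings and Gaussian binomial coefficients -/

/-- The field `ℚ(v)` of rational functions in one indeterminate. -/
abbrev Qv : Type := RatFunc ℚ

/-- The indeterminate `v`. -/
def v : Qv := RatFunc.X

/-- The subring `𝒵 = ℤ[v, v⁻¹]` of `ℚ(v)`. -/
def Zv : Subalgebra ℤ Qv := Algebra.adjoin ℤ {v, v⁻¹}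

/-- The quantum integer `[i] = (v^i - v^(-i)) / (v - v^(-1))`, for `i ∈ ℤ`. -/
def qint (i : ℤ) : Qv := (v ^ i - v ^ (-i)) / (v - v⁻¹)

/-- The Gaussian binomial `[N; t] = [N][N-1]⋯[N-t+1] / ([1][2]⋯[t])`, for `N ∈ ℤ`, `t ∈ ℕ`. -/
def gbinom (N : ℤ) (t : ℕ) : Qv :=
  (∏ s ∈ Finset.range t, qint (N - (s : ℤ))) / ∏ s ∈ Finset.range t, qint ((s : ℤ) + 1)

/-- `[μ; l] = ∏ᵢ [μᵢ; lᵢ]` for `μ ∈ ℤⁿ`, `l ∈ ℕⁿ`. -/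
def gbinomVec {n : ℕ} (μ : Fin n → ℤ) (l : Fin n → ℕ) : Qv := ∏ i, gbinom (μ i) (l i)

/-! ### The Hecke algebra of the symmetric group -/

/-- The defining relations of the Hecke algebra of the symmetric group on `r` letters, over
`ℚ(v)` and with parameter `q = v²`; the generators are `T_i`, `i` running over `r - 1` values. -/
inductive HeckeRel (r : ℕ) :
    FreeAlgebra Qv (Fin (r - 1)) → FreeAlgebra Qv (Fin (r - 1)) → Prop
  | quad (i : Fin (r - 1)) :
      HeckeRel r ((FreeAlgebra.ι Qv i + 1) *
        (FreeAlgebra.ι Qv i - algebraMap Qv (FreeAlgebra Qv (Fin (r - 1))) (v ^ 2))) 0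
  | braid (i j : Fin (r - 1)) (h : (i : ℕ) + 1 = j) :
      HeckeRel r (FreeAlgebra.ι Qv i * FreeAlgebra.ι Qv j * FreeAlgebra.ι Qv i)
        (FreeAlgebra.ι Qv j * FreeAlgebra.ι Qv i * FreeAlgebra.ι Qv j)
  | comm (i j : Fin (r - 1)) (h : (i : ℕ) + 1 < j ∨ (j : ℕ) + 1 < i) :
      HeckeRel r (FreeAlgebra.ι Qv i * FreeAlgebra.ι Qv j)
        (FreeAlgebra.ι Qv j * FreeAlgebra.ι Qv i)

/-- The Hecke algebra over `ℚ(v)` of the symmetric group on `r` letters. -/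
def Hecke (r : ℕ) : Type := RingQuot (HeckeRel r)

instance (r : ℕ) : Ring (Hecke r) := inferInstanceAs (Ring (RingQuot (HeckeRel r)))

instance (r : ℕ) : Algebra Qv (Hecke r) :=
  inferInstanceAs (Algebra Qv (RingQuot (HeckeRel r)))

/-- The generator `T_i` of the Hecke algebra. -/
def Hecke.gen {r : ℕ} (i : Fin (r - 1)) : Hecke r :=
  RingQuot.mkAlgHom Qv (HeckeRel r) (FreeAlgebra.ι Qv i)

/-- The simple transposition `s_i = (i, i+1)`. -/
def simpleRefl {r : ℕ} (i : Fin (r - 1)) : Equiv.Perm (Fin r) :=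
  Equiv.swap ⟨i, by omega⟩ ⟨i + 1, by omega⟩

/-- The permutation `s_{i₁} ⋯ s_{iₘ}` spelled by the word `i₁, …, iₘ`. -/
def wordProd {r : ℕ} (l : List (Fin (r - 1))) : Equiv.Perm (Fin r) := (l.map simpleRefl).prod

/-- A word is reduced if no shorter word spells the same permutation. -/
def IsReduced {r : ℕ} (l : List (Fin (r - 1))) : Prop :=
  ∀ l' : List (Fin (r - 1)), wordProd l' = wordProd l → l.length ≤ l'.length

theorem exists_word {r : ℕ} (w : Equiv.Perm (Fin r)) :
    ∃ l : List (Fin (r - 1)), wordProd l = w := by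
  rcases r with _ | r
  · exact ⟨[], Subsingleton.elim _ _⟩
  · have hw : w ∈ Submonoid.closure
        (Set.range fun i : Fin r => Equiv.swap i.castSucc i.succ) := by
      rw [Equiv.Perm.mclosure_swap_castSucc_succ]; trivial
    induction hw using Submonoid.closure_induction with
    | mem x hx =>
      obtain ⟨i, rfl⟩ := hx
      exact ⟨[i], by simp [wordProd, simpleRefl]; rfl⟩
    | one => exact ⟨[], rfl⟩
    | mul x y _ _ hx hy =>
      obtain ⟨l, rfl⟩ := hx
      obtain ⟨m, rfl⟩ := hy
      exact ⟨l ++ m, by simp [wordProd]⟩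

theorem exists_reducedWord {r : ℕ} (w : Equiv.Perm (Fin r)) :
    ∃ l : List (Fin (r - 1)), wordProd l = w ∧ IsReduced l := by
  obtain ⟨l, hl, hmin⟩ := exists_minimalFor_of_wellFoundedLT
    (fun l : List (Fin (r - 1)) => wordProd l = w) List.length (exists_word w)
  refine ⟨l, hl, fun l' hl' => ?_⟩
  by_contra hlt
  exact hlt (hmin (hl'.trans hl) (by omega))

/-- A reduced word of `w`. -/
def reducedWord {r : ℕ} (w : Equiv.Perm (Fin r)) : List (Fin (r - 1)) :=
  (exists_reducedWord w).choose

/-- The length of `w`. -/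
def length {r : ℕ} (w : Equiv.Perm (Fin r)) : ℕ := (reducedWord w).length

/-- `T_w = T_{i₁} ⋯ T_{iₘ}` where `w = s_{i₁} ⋯ s_{iₘ}` is reduced. -/
def Hecke.T {r : ℕ} (w : Equiv.Perm (Fin r)) : Hecke r :=
  ((reducedWord w).map Hecke.gen).prod

/-! ### Compositions, Young subgroups and double cosets -/

/-- `Λ(n,r)`: the vectors in `ℕⁿ` with sum `r`. -/
abbrev Comp (n r : ℕ) : Type := {l : Fin n → ℕ // ∑ i, l i = r}

instance (n r : ℕ) : Fintype (Comp n r) :=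
  Fintype.subtype (Finset.piAntidiag Finset.univ r) (by simp)

/-- The block `R_i` of the letters: the `l i` consecutive letters that follow the first
`∑_{t < i} l t` ones (letters are numbered from `0`). -/
def block {n r : ℕ} (l : Comp n r) (i : Fin n) : Finset (Fin r) :=
  Finset.univ.filter fun x =>
    (∑ t ∈ Finset.univ.filter (· < i), l.1 t) ≤ (x : ℕ) ∧
      (x : ℕ) < (∑ t ∈ Finset.univ.filter (· < i), l.1 t) + l.1 i

/-- The Young subgroup: the permutations that preserve every block. -/
def young {n r : ℕ} (l : Comp n r) : Subgroup (Equiv.Perm (Fin r)) where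
  carrier := {w | ∀ i x, w x ∈ block l i ↔ x ∈ block l i}
  mul_mem' := fun ha hb i x => (ha i _).trans (hb i x)
  one_mem' := fun _ _ => Iff.rfl
  inv_mem' := fun {a} ha i x => by simpa using (ha i (a⁻¹ x)).symm

/-- The distinguished `(S_l, S_m)` double coset representatives: the elements of minimal length
in their double coset. -/
def IsDistinguished {n r : ℕ} (l m : Comp n r) (d : Equiv.Perm (Fin r)) : Prop :=
  ∀ w ∈ DoubleCoset.doubleCoset d (young l : Set (Equiv.Perm (Fin r))) (young m),
    length d ≤ length w

/-- The matrix with entries `|R_i^l ∩ d R_j^m|`. -/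
def relMatrix {n r : ℕ} (l m : Comp n r) (d : Equiv.Perm (Fin r)) : Matrix (Fin n) (Fin n) ℕ :=
  fun i j => (block l i ∩ (block m j).image d).card

open Classical in
/-- `x_l`, the sum of the `T_w` over the Young subgroup of `l`. -/
def xElt {n r : ℕ} (l : Comp n r) : Hecke r :=
  ∑ w ∈ Finset.univ.filter (· ∈ young l), Hecke.T w

open Classical in
/-- The sum of the `T_x` over the double coset `S_l d S_m`. -/
def dcSum {n r : ℕ} (l m : Comp n r) (d : Equiv.Perm (Fin r)) : Hecke r :=
  ∑ x ∈ Finset.univ.filter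
    (· ∈ DoubleCoset.doubleCoset d (young l : Set (Equiv.Perm (Fin r))) (young m)), Hecke.T x

/-! ### The `q`-Schur algebra -/

/-- The right ideal `x_l H(r)`, as a right `H(r)`-module. -/
abbrev permMod {n r : ℕ} (l : Comp n r) : Submodule (Hecke r)ᵐᵒᵖ (Hecke r) :=
  Submodule.span (Hecke r)ᵐᵒᵖ {xElt l}

/-- The right `H(r)`-module `⨁_l x_l H(r)`, `l` running over `Λ(n,r)`. As `Λ(n,r)` is finite, the
direct sum is the module of all families of elements of the summands. -/
abbrev TensorMod (n r : ℕ) : Type := (l : Comp n r) → permMod l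

/-- The `q`-Schur algebra over `ℚ(v)`: the endomorphism algebra of the right module
`⨁_l x_l H(r)`; the product is composition of maps. -/
abbrev QSchur (n r : ℕ) : Type := Module.End (Hecke r)ᵐᵒᵖ (TensorMod n r)

/-- The element `x_l h` of the summand with index `l`. -/
def xMul {n r : ℕ} (l : Comp n r) (h : Hecke r) : permMod l :=
  ⟨xElt l * h, Submodule.mem_span_singleton.2 ⟨MulOpposite.op h, rfl⟩⟩

/-- `f` is the map `φ_{l,m}^d`: it sends `x_k h` to `δ_{m,k} ∑_{x ∈ S_l d S_m} T_x h`, the latter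
lying in the summand `x_l H(r)`. At most one module endomorphism `f` has this property. -/
def IsPhi {n r : ℕ} (l m : Comp n r) (d : Equiv.Perm (Fin r)) (f : QSchur n r) : Prop :=
  ∀ (k k' : Comp n r) (h : Hecke r),
    ((f (Pi.single k (xMul k h)) k' : permMod k') : Hecke r) =
      if k = m ∧ k' = l then dcSum l m d * h else 0

open Classical in
/-- The element `φ_{l,m}^d` of the `q`-Schur algebra. -/
def phi {n r : ℕ} (l m : Comp n r) (d : Equiv.Perm (Fin r)) : QSchur n r :=
  if h : ∃ f, IsPhi l m d f then h.choose else 0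

/-- The sum `σ(A)` of the entries of a matrix. -/
def sigma {n : ℕ} (A : Matrix (Fin n) (Fin n) ℕ) : ℕ := ∑ i, ∑ j, A i j

/-- `Θ(n,r)`: the `n × n` matrices over `ℕ` with sum of entries `r`. -/
abbrev Theta (n r : ℕ) : Type := {A : Matrix (Fin n) (Fin n) ℕ // sigma A = r}

/-- The row sums of a matrix. -/
def ro {n r : ℕ} (A : Theta n r) : Comp n r := ⟨fun i => ∑ j, A.1 i j, A.2⟩

/-- The column sums of a matrix. -/
def co {n r : ℕ} (A : Theta n r) : Comp n r :=
  ⟨fun j => ∑ i, A.1 i j, Finset.sum_comm.trans A.2⟩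

/-- `d_A = ∑ a_{i,j} a_{k,l}` over all `i, j, k, l` with `i ≥ k` and `j < l`. -/
def dA {n : ℕ} (A : Matrix (Fin n) (Fin n) ℕ) : ℕ :=
  ∑ i, ∑ j, ∑ k, ∑ l, if k ≤ i ∧ j < l then A i j * A k l else 0

open Classical in
/-- The element `[A] = v^(-d_A) φ_{l,m}^d`, where `l`, `m` are the row and column sums of `A` and
`d` is the distinguished double coset representative with matrix `A`. -/
def stdElt {n r : ℕ} (A : Theta n r) : QSchur n r :=
  if h : ∃ d, IsDistinguished (ro A) (co A) d ∧ relMatrix (ro A) (co A) d = A.1 then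
    v ^ (-(dA A.1 : ℤ)) • phi (ro A) (co A) h.choose
  else 0

/-! ### The elements `A(δ,λ)` and the module `V(n)` -/

/-- `Θ^±(n)`: the `n × n` matrices over `ℕ` with zero diagonal. -/
abbrev OffDiag (n : ℕ) : Type := {A : Matrix (Fin n) (Fin n) ℕ // ∀ i, A i i = 0}

theorem sigma_add_diagonal {n r : ℕ} {A : Matrix (Fin n) (Fin n) ℕ} (h : sigma A ≤ r)
    (μ : Comp n (r - sigma A)) : sigma (A + Matrix.diagonal μ.1) = r := by
  have h1 : sigma (A + Matrix.diagonal μ.1) = sigma A + ∑ i, μ.1 i := by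
    simp [sigma, Finset.sum_add_distrib, Matrix.diagonal_apply]
  rw [h1, μ.2]
  omega

/-- `A(δ,λ,r) = ∑_μ v^(μ·δ) [μ; λ] [A + diag μ]`, the sum over `μ ∈ Λ(n, r - σ(A))`; it is empty
when `r < σ(A)`. -/
def eltR {n : ℕ} (A : OffDiag n) (δ : Fin n → ℤ) (l : Fin n → ℕ) (r : ℕ) : QSchur n r :=
  if h : sigma A.1 ≤ r then
    ∑ μ : Comp n (r - sigma A.1),
      (v ^ (∑ i, (μ.1 i : ℤ) * δ i) * gbinomVec (fun i => (μ.1 i : ℤ)) l) •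
        stdElt (⟨A.1 + Matrix.diagonal μ.1, sigma_add_diagonal h μ⟩ : Theta n r)
  else 0

/-- `A(δ,λ) = (A(δ,λ,r))_{r ≥ 0}` in the product of all `q`-Schur algebras. -/
def elt {n : ℕ} (A : OffDiag n) (δ : Fin n → ℤ) (l : Fin n → ℕ) : (r : ℕ) → QSchur n r :=
  fun r => eltR A δ l r

/-- `A(δ) = A(δ,0)`. -/
def elt₀ {n : ℕ} (A : OffDiag n) (δ : Fin n → ℤ) : (r : ℕ) → QSchur n r := elt A δ 0

/-- The zero matrix. -/
def zeroMat (n : ℕ) : OffDiag n := ⟨0, fun _ => rfl⟩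

/-- `V(n)`: the `𝒵`-submodule spanned by all `A(δ,λ)` with `δ ∈ ℤⁿ`, `λ ∈ ℕⁿ`. -/
def V (n : ℕ) : Submodule Zv ((r : ℕ) → QSchur n r) :=
  Submodule.span Zv {x | ∃ (A : OffDiag n) (δ : Fin n → ℤ) (l : Fin n → ℕ), x = elt A δ l}

/-- The index set: triples `(A, δ, λ)` with `A ∈ Θ^±(n)`, `δ, λ ∈ ℕⁿ`, `δ_i ∈ {0,1}`. -/
abbrev Index (n : ℕ) : Type :=
  OffDiag n × {δ : Fin n → ℕ // ∀ i, δ i = 0 ∨ δ i = 1} × (Fin n → ℕ)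

/-- `0(δ,λ) A(0)`. -/
def fam₁ {n : ℕ} (t : Index n) : (r : ℕ) → QSchur n r :=
  elt (zeroMat n) (fun i => (t.2.1.1 i : ℤ)) t.2.2 * elt₀ t.1 0

/-- `A(0) 0(δ,λ)`. -/
def fam₂ {n : ℕ} (t : Index n) : (r : ℕ) → QSchur n r :=
  elt₀ t.1 0 * elt (zeroMat n) (fun i => (t.2.1.1 i : ℤ)) t.2.2

/-- `A(δ,λ)`. -/
def fam₃ {n : ℕ} (t : Index n) : (r : ℕ) → QSchur n r :=
  elt t.1 (fun i => (t.2.1.1 i : ℤ)) t.2.2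

/-- The family `b` is a `𝒵`-basis of the submodule `W`. -/
def IsBasisOf {ι M : Type*} [AddCommGroup M] [Module Zv M] (b : ι → M) (W : Submodule Zv M) :
    Prop :=
  LinearIndependent Zv b ∧ Submodule.span Zv (Set.range b) = W

end BLM

end

/-!
The elements `[A]`, `A` running over the matrices with sum of entries `r`, are linearly independent
in the `q`-Schur algebra, and for diagonal `D` the element `[D]` is the projection onto the summand
whose index is the diagonal of `D`. So `[D] [A]` is `[A]` or `0` according to whether `D` carries
the row sums of `A` or not, and likewise for `[A] [D]` and column sums. Hence all three families
consist of series `∑ F(μ) [A + diag μ]` (`series`), where `A` is fixed and `F` is the function `μ ↦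
v^((μ + a) ⬝ δ) [μ + a; λ]` (`qfunVec`), with `a` the vector of row sums of `A` for `fam₁`, of
column sums for `fam₂`, and `0` for `fam₃`. Since `F` can be recovered from its series, everything
reduces to the `𝒵`-module of functions on `ℕⁿ` spanned by the `qfunVec 0 δ λ` with `δ ∈ ℤⁿ`
(`isBasisOf_series`): for each `a` it must have the `qfunVec a δ λ` with `δ ∈ {0,1}ⁿ` as a basis.
Both spans and linear independence pass to products of functions in separate variables
(`span_range_prod`, `linearIndependent_prod`), so it is enough to treat one variable. There

* the Pascal rule shows that the span does not depend on the shift `a` (`qspan_eq`);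
* the recursion `[t+1] [N; t+1] = [N-t] [N; t]` is a linear relation between the functions with
  exponents `δ`, `δ - 1`, `δ - 2`, which brings all exponents into `{0, 1}` (`span_qfun_zeroOne`);
* in terms of `X = v^N` the functions are Laurent polynomials, and in the order
  `(δ, t) = (0,0), (1,0), (0,1), (1,1), …` their new extreme terms are `1, X, X⁻¹, X², …`, so that
  they are triangular with respect to the characters `N ↦ v^(jN)`, which are independent by
  Dedekind's theorem (`linearIndependent_qfun`).

The facts on `[A]` rest on the Hecke algebra. Counting inversions gives Matsumoto's theorem
(`Hecke.word_eq_word`) and with it the rule for `T_i T_w`; the regular representation, whose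
relations hold since left and right multiplications commute, gives the independence of the `T_w`
(`Hecke.coeff_T`). A sum of `T_w` over a double coset of Young subgroups is an eigenvector for the
`T_i` of these subgroups on both sides, so `x_λ` multiplies it by a Poincaré polynomial, which is
invertible in `ℚ(v)`. This makes `φ_{λμ}^d` well defined (`exists_isPhi`) without any analysis of
distinguished coset representatives. Such a representative exists for each `A`, because
every matrix is the relative position matrix of some permutation (`exists_relMatrix_eq`).
-/

noncomputable section

namespace BLM

/-! ### Inversions and length of permutations -/

section Inversions

variable {r : ℕ}

/-- The letter `i` exchanged by the simple transposition `s_i = (i, i+1)`. -/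
def lo (i : Fin (r - 1)) : Fin r := ⟨i, by omega⟩

/-- The letter `i + 1` exchanged by the simple transposition `s_i = (i, i+1)`. -/
def hi (i : Fin (r - 1)) : Fin r := ⟨i + 1, by omega⟩

theorem simpleRefl_eq_swap (i : Fin (r - 1)) : simpleRefl i = Equiv.swap (lo i) (hi i) := rfl

theorem lo_lt_hi (i : Fin (r - 1)) : lo i < hi i := by simp [lo, hi, Fin.lt_def]

theorem lo_ne_hi (i : Fin (r - 1)) : lo i ≠ hi i := (lo_lt_hi i).ne

@[simp] theorem simpleRefl_lo (i : Fin (r - 1)) : simpleRefl i (lo i) = hi i :=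
  Equiv.swap_apply_left _ _

@[simp] theorem simpleRefl_hi (i : Fin (r - 1)) : simpleRefl i (hi i) = lo i :=
  Equiv.swap_apply_right _ _

theorem simpleRefl_of_ne {i : Fin (r - 1)} {x : Fin r} (h1 : x ≠ lo i) (h2 : x ≠ hi i) :
    simpleRefl i x = x := Equiv.swap_apply_of_ne_of_ne h1 h2

@[simp] theorem simpleRefl_mul_self (i : Fin (r - 1)) : simpleRefl i * simpleRefl i = 1 :=
  Equiv.swap_mul_self _ _

@[simp] theorem simpleRefl_inv (i : Fin (r - 1)) : (simpleRefl i)⁻¹ = simpleRefl i :=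
  Equiv.swap_inv _ _

@[simp] theorem simpleRefl_simpleRefl (i : Fin (r - 1)) (x : Fin r) :
    simpleRefl i (simpleRefl i x) = x := by
  rw [← Equiv.Perm.mul_apply, simpleRefl_mul_self, Equiv.Perm.one_apply]

@[simp] theorem simpleRefl_mul_cancel_left (i : Fin (r - 1)) (w : Equiv.Perm (Fin r)) :
    simpleRefl i * (simpleRefl i * w) = w := by rw [← mul_assoc]; simp

@[simp] theorem simpleRefl_mul_cancel_right (i : Fin (r - 1)) (w : Equiv.Perm (Fin r)) :
    w * simpleRefl i * simpleRefl i = w := by rw [mul_assoc]; simp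

theorem simpleRefl_lt {i : Fin (r - 1)} {a b : Fin r} (hab : a < b)
    (h : ¬(a = lo i ∧ b = hi i)) : simpleRefl i a < simpleRefl i b := by
  rw [simpleRefl_eq_swap, Equiv.swap_apply_def, Equiv.swap_apply_def]
  simp only [lo, hi, Fin.ext_iff, Fin.lt_def] at *
  split_ifs <;> simp <;> omega

/-- The inversions of `w`: the pairs `a < b` with `w b < w a`. -/
def invs (w : Equiv.Perm (Fin r)) : Finset (Fin r × Fin r) :=
  Finset.univ.filter fun p => p.1 < p.2 ∧ w p.2 < w p.1

/-- The number of inversions of `w`. -/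
def inv (w : Equiv.Perm (Fin r)) : ℕ := (invs w).card

theorem mem_invs {w : Equiv.Perm (Fin r)} {a b : Fin r} :
    (a, b) ∈ invs w ↔ a < b ∧ w b < w a := by simp [invs]

@[simp] theorem inv_one : inv (1 : Equiv.Perm (Fin r)) = 0 := by
  rw [inv, Finset.card_eq_zero, Finset.eq_empty_iff_forall_notMem]
  rintro ⟨a, b⟩ h
  rw [mem_invs] at h
  exact lt_asymm h.1 h.2

theorem inv_inv (w : Equiv.Perm (Fin r)) : inv w⁻¹ = inv w := by
  refine Finset.card_bij' (fun p _ => (w⁻¹ p.2, w⁻¹ p.1)) (fun p _ => (w p.2, w p.1)) ?_ ?_ ?_ ?_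
  · rintro ⟨a, b⟩ h
    rw [mem_invs] at h ⊢
    simpa using h.symm
  · rintro ⟨a, b⟩ h
    rw [mem_invs] at h ⊢
    simpa using h.symm
  · simp
  · simp

theorem inv_mul_simpleRefl {w : Equiv.Perm (Fin r)} {i : Fin (r - 1)} (h : w (lo i) < w (hi i)) :
    inv (w * simpleRefl i) = inv w + 1 := by
  have key : invs (w * simpleRefl i) = insert (lo i, hi i)
      ((invs w).map (Equiv.prodCongr (simpleRefl i) (simpleRefl i)).toEmbedding) := by
    ext ⟨a, b⟩
    have hmap : (a, b) ∈ (invs w).map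
        (Equiv.prodCongr (simpleRefl i) (simpleRefl i)).toEmbedding ↔
        (simpleRefl i a, simpleRefl i b) ∈ invs w := by
      rw [Finset.mem_map_equiv]
      simp [simpleRefl_eq_swap]
    rw [Finset.mem_insert, hmap, mem_invs, mem_invs, Equiv.Perm.mul_apply, Equiv.Perm.mul_apply]
    by_cases hab : (a, b) = (lo i, hi i)
    · obtain ⟨rfl, rfl⟩ := Prod.mk.inj hab
      simpa using ⟨lo_lt_hi i, h⟩
    · simp only [hab, false_or]
      refine and_congr_left fun hw => ⟨fun hlt => simpleRefl_lt hlt fun hc => hab ?_, fun hlt => ?_⟩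
      · rw [hc.1, hc.2]
      · have := simpleRefl_lt (i := i) hlt ?_
        · simpa using this
        · rintro ⟨h1, h2⟩
          rw [h1, h2] at hw
          exact lt_asymm h hw
  rw [inv, key, Finset.card_insert_of_notMem, Finset.card_map]
  · rfl
  · rw [Finset.mem_map_equiv]
    have : (Equiv.prodCongr (simpleRefl i) (simpleRefl i)).symm (lo i, hi i) = (hi i, lo i) := by
      simp [simpleRefl_eq_swap]
    rw [this, mem_invs]
    exact fun hc => lt_asymm hc.1 (lo_lt_hi i)

/-- `i` is a left ascent of `w`; equivalently `s_i w` is longer than `w`. -/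
def Asc (i : Fin (r - 1)) (w : Equiv.Perm (Fin r)) : Prop := w⁻¹ (lo i) < w⁻¹ (hi i)

instance (i : Fin (r - 1)) (w : Equiv.Perm (Fin r)) : Decidable (Asc i w) :=
  inferInstanceAs (Decidable (_ < _))

theorem not_asc {i : Fin (r - 1)} {w : Equiv.Perm (Fin r)} :
    ¬ Asc i w ↔ w⁻¹ (hi i) < w⁻¹ (lo i) := by
  rw [Asc, not_lt]
  exact ⟨fun h => lt_of_le_of_ne h fun h => lo_ne_hi i (w⁻¹.injective h).symm, le_of_lt⟩

theorem asc_simpleRefl_mul {i : Fin (r - 1)} {w : Equiv.Perm (Fin r)} :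
    Asc i (simpleRefl i * w) ↔ ¬ Asc i w := by
  rw [not_asc]; simp [Asc]

theorem inv_of_asc {i : Fin (r - 1)} {w : Equiv.Perm (Fin r)} (h : Asc i w) :
    inv (simpleRefl i * w) = inv w + 1 := by
  rw [← inv_inv, mul_inv_rev, simpleRefl_inv, inv_mul_simpleRefl h, inv_inv]

theorem inv_of_not_asc {i : Fin (r - 1)} {w : Equiv.Perm (Fin r)} (h : ¬ Asc i w) :
    inv w = inv (simpleRefl i * w) + 1 := by
  rw [← inv_of_asc (asc_simpleRefl_mul.2 h), simpleRefl_mul_cancel_left]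

theorem inv_simpleRefl_mul_le (i : Fin (r - 1)) (w : Equiv.Perm (Fin r)) :
    inv (simpleRefl i * w) ≤ inv w + 1 := by
  by_cases h : Asc i w
  · exact (inv_of_asc h).le
  · have := inv_of_not_asc h
    omega

@[simp] theorem wordProd_nil : wordProd ([] : List (Fin (r - 1))) = 1 := rfl

@[simp] theorem wordProd_cons (i : Fin (r - 1)) (l : List (Fin (r - 1))) :
    wordProd (i :: l) = simpleRefl i * wordProd l := by simp [wordProd]

theorem wordProd_append (l l' : List (Fin (r - 1))) :
    wordProd (l ++ l') = wordProd l * wordProd l' := by simp [wordProd]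

theorem inv_wordProd_le (l : List (Fin (r - 1))) : inv (wordProd l) ≤ l.length := by
  induction l with
  | nil => simp
  | cons i l ih =>
    rw [wordProd_cons, List.length_cons]
    exact (inv_simpleRefl_mul_le i _).trans (by omega)

/-- A permutation without descents is increasing, hence trivial. -/
theorem eq_one_of_forall_asc {w : Equiv.Perm (Fin r)} (h : ∀ i, Asc i w) : w = 1 := by
  have hmono : StrictMono (w⁻¹ : Equiv.Perm (Fin r)) := by
    rcases r with _ | r
    · exact fun a => a.elim0
    · rw [Fin.strictMono_iff_lt_succ]
      exact fun i => h i
  have hid : (w⁻¹ : Equiv.Perm (Fin r)) = 1 := by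
    ext x
    have := Subsingleton.elim (hmono.orderIsoOfSurjective _ (w⁻¹).surjective) (OrderIso.refl _)
    exact congrArg Fin.val (congrArg (fun f : Fin r ≃o Fin r => f x) this)
  simpa using hid

theorem exists_word_length_eq_inv (w : Equiv.Perm (Fin r)) :
    ∃ l, wordProd l = w ∧ l.length = inv w := by
  induction hn : inv w using Nat.strong_induction_on generalizing w with
  | _ n ih =>
    by_cases h : ∀ i, Asc i w
    · obtain rfl := eq_one_of_forall_asc h
      exact ⟨[], rfl, by simpa using hn⟩
    · push Not at h
      obtain ⟨i, hi⟩ := h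
      have := inv_of_not_asc hi
      obtain ⟨l, hl, hlen⟩ := ih _ (by omega) (simpleRefl i * w) rfl
      exact ⟨i :: l, by simp [hl], by simp [hlen]; omega⟩

theorem isReduced_iff {l : List (Fin (r - 1))} : IsReduced l ↔ l.length = inv (wordProd l) := by
  constructor
  · intro h
    obtain ⟨l', hl', hlen⟩ := exists_word_length_eq_inv (wordProd l)
    exact le_antisymm ((h l' hl').trans hlen.le) (inv_wordProd_le l)
  · intro h l' hl'
    rw [h, ← hl']
    exact inv_wordProd_le l'

theorem wordProd_reducedWord (w : Equiv.Perm (Fin r)) : wordProd (reducedWord w) = w :=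
  (exists_reducedWord w).choose_spec.1

theorem length_reducedWord (w : Equiv.Perm (Fin r)) : (reducedWord w).length = inv w := by
  have := isReduced_iff.1 (exists_reducedWord w).choose_spec.2
  rw [(exists_reducedWord w).choose_spec.1] at this
  exact this

end Inversions

/-! ### The basis elements `T_w` of the Hecke algebra -/

section HeckeMul

variable {r : ℕ}

/-- The product of generators spelled by a word. -/
def Hecke.word (l : List (Fin (r - 1))) : Hecke r := (l.map Hecke.gen).prod

@[simp] theorem Hecke.word_cons (i : Fin (r - 1)) (l : List (Fin (r - 1))) :
    Hecke.word (i :: l) = Hecke.gen i * Hecke.word l := by simp [Hecke.word]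

theorem Hecke.word_append (l l' : List (Fin (r - 1))) :
    Hecke.word (l ++ l') = Hecke.word l * Hecke.word l' := by simp [Hecke.word]

/-- The quotient map from the free algebra onto the Hecke algebra. -/
def Hecke.mk (r : ℕ) : FreeAlgebra Qv (Fin (r - 1)) →ₐ[Qv] Hecke r :=
  RingQuot.mkAlgHom Qv (HeckeRel r)

theorem Hecke.mk_ι (i : Fin (r - 1)) : Hecke.mk r (FreeAlgebra.ι Qv i) = Hecke.gen i := rfl

theorem Hecke.mk_eq {a b : FreeAlgebra Qv (Fin (r - 1))} (h : HeckeRel r a b) :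
    Hecke.mk r a = Hecke.mk r b := RingQuot.mkAlgHom_rel Qv h

theorem Hecke.gen_mul_gen (i : Fin (r - 1)) :
    Hecke.gen i * Hecke.gen i = (v ^ 2 - 1) • Hecke.gen i + v ^ 2 • (1 : Hecke r) := by
  have h := Hecke.mk_eq (HeckeRel.quad i)
  simp only [map_mul, map_add, map_sub, map_one, map_zero, Hecke.mk_ι, AlgHom.commutes] at h
  rw [Algebra.algebraMap_eq_smul_one] at h
  rw [← sub_eq_zero, ← h]
  simp only [add_mul, mul_sub, one_mul, mul_smul_comm, mul_one, sub_smul, one_smul, smul_add]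
  abel

theorem Hecke.gen_braid {i j : Fin (r - 1)} (h : (i : ℕ) + 1 = j) :
    Hecke.gen i * Hecke.gen j * Hecke.gen i = Hecke.gen j * Hecke.gen i * Hecke.gen j := by
  simpa only [map_mul, Hecke.mk_ι] using Hecke.mk_eq (HeckeRel.braid i j h)

theorem Hecke.gen_comm {i j : Fin (r - 1)} (h : (i : ℕ) + 1 < j ∨ (j : ℕ) + 1 < i) :
    Hecke.gen i * Hecke.gen j = Hecke.gen j * Hecke.gen i := by
  simpa only [map_mul, Hecke.mk_ι] using Hecke.mk_eq (HeckeRel.comm i j h)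

theorem simpleRefl_braid {i j : Fin (r - 1)} (h : (i : ℕ) + 1 = j) :
    simpleRefl i * simpleRefl j * simpleRefl i = simpleRefl j * simpleRefl i * simpleRefl j := by
  have e1 : hi i = lo j := Fin.ext h
  have e2 : simpleRefl i (hi j) = hi j :=
    simpleRefl_of_ne (by simp [lo, hi, Fin.ext_iff]; omega) (by simp [hi, Fin.ext_iff]; omega)
  have e3 : simpleRefl j (lo i) = lo i :=
    simpleRefl_of_ne (by simp [lo, Fin.ext_iff]; omega) (by simp [lo, hi, Fin.ext_iff]; omega)
  have e4 : simpleRefl i (lo j) = lo i := by rw [← e1, simpleRefl_hi]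
  have e5 : simpleRefl j (hi i) = hi j := by rw [e1, simpleRefl_lo]
  rw [simpleRefl_eq_swap j, Equiv.mul_swap_eq_swap_mul, mul_assoc, simpleRefl_mul_self, e4, e2,
    ← simpleRefl_eq_swap j, simpleRefl_eq_swap i, Equiv.mul_swap_eq_swap_mul, mul_assoc,
    simpleRefl_mul_self, e3, e5]

theorem simpleRefl_comm {i j : Fin (r - 1)} (h : (i : ℕ) + 1 < j ∨ (j : ℕ) + 1 < i) :
    simpleRefl i * simpleRefl j = simpleRefl j * simpleRefl i := by
  have h1 : simpleRefl i (lo j) = lo j :=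
    simpleRefl_of_ne (by simp [lo, Fin.ext_iff]; omega) (by simp [lo, hi, Fin.ext_iff]; omega)
  have h2 : simpleRefl i (hi j) = hi j :=
    simpleRefl_of_ne (by simp [lo, hi, Fin.ext_iff]; omega) (by simp [hi, Fin.ext_iff]; omega)
  rw [simpleRefl_eq_swap j, Equiv.mul_swap_eq_swap_mul, h1, h2]

theorem asc_simpleRefl_mul_of_far {i j : Fin (r - 1)} {w : Equiv.Perm (Fin r)}
    (h : (i : ℕ) + 1 < j ∨ (j : ℕ) + 1 < i) : Asc j (simpleRefl i * w) ↔ Asc j w := by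
  have h1 : simpleRefl i (lo j) = lo j :=
    simpleRefl_of_ne (by simp [lo, Fin.ext_iff]; omega) (by simp [lo, hi, Fin.ext_iff]; omega)
  have h2 : simpleRefl i (hi j) = hi j :=
    simpleRefl_of_ne (by simp [lo, hi, Fin.ext_iff]; omega) (by simp [hi, Fin.ext_iff]; omega)
  simp [Asc, h1, h2]

/-- A permutation with two adjacent left descents `i`, `j` has a reduced word that begins with
`i, j, i`. -/
theorem exists_of_adjacent_descents {i j : Fin (r - 1)} (hij : (i : ℕ) + 1 = j)
    {w : Equiv.Perm (Fin r)} (h1 : ¬ Asc i w) (h2 : ¬ Asc j w) :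
    ∃ x, w = simpleRefl i * simpleRefl j * simpleRefl i * x ∧
      inv (simpleRefl i * x) = inv x + 1 ∧ inv (simpleRefl j * x) = inv x + 1 ∧
      inv w = inv x + 3 := by
  have e1 : hi i = lo j := Fin.ext hij
  have e2 : simpleRefl i (hi j) = hi j :=
    simpleRefl_of_ne (by simp [lo, hi, Fin.ext_iff]; omega) (by simp [hi, Fin.ext_iff]; omega)
  have e3 : simpleRefl j (lo i) = lo i :=
    simpleRefl_of_ne (by simp [lo, Fin.ext_iff]; omega) (by simp [lo, hi, Fin.ext_iff]; omega)
  have e4 : simpleRefl i (lo j) = lo i := by rw [← e1, simpleRefl_hi]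
  have e5 : simpleRefl j (hi i) = hi j := by rw [e1, simpleRefl_lo]
  have d1 := not_asc.1 h1
  have d2 := not_asc.1 h2
  have d3 : ¬ Asc j (simpleRefl i * w) := by
    rw [not_asc]; simp only [mul_inv_rev, simpleRefl_inv, Equiv.Perm.mul_apply, e2, e4]
    exact d2.trans (e1 ▸ d1)
  have d4 : ¬ Asc i (simpleRefl j * (simpleRefl i * w)) := by
    rw [not_asc]; simp only [mul_inv_rev, simpleRefl_inv, Equiv.Perm.mul_apply, e5, e3, e2]
    simpa [e1] using d2
  have d5 : Asc j (simpleRefl i * (simpleRefl j * (simpleRefl i * w))) := by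
    rw [Asc]; simp only [mul_inv_rev, simpleRefl_inv, Equiv.Perm.mul_apply, e4, e3, e2]
    simpa [e1, e4] using d1
  have k1 := inv_of_not_asc h1
  have k2 := inv_of_not_asc d3
  have k3 := inv_of_not_asc d4
  refine ⟨simpleRefl i * (simpleRefl j * (simpleRefl i * w)), ?_, ?_, inv_of_asc d5, by omega⟩
  · simp only [mul_assoc, simpleRefl_mul_cancel_left]
  · rw [simpleRefl_mul_cancel_left]; omega

/-- Matsumoto's theorem for the Hecke algebra: the product of the generators along a reduced word
only depends on the permutation that the word spells. -/
theorem Hecke.word_eq_word {l l' : List (Fin (r - 1))} (h : wordProd l = wordProd l')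
    (hl : l.length = inv (wordProd l)) (hl' : l'.length = inv (wordProd l')) :
    Hecke.word l = Hecke.word l' := by
  induction hn : l.length using Nat.strong_induction_on generalizing l l' with
  | _ n ih =>
    rcases l with _ | ⟨i, u⟩
    · rw [← h, ← hl] at hl'
      rw [List.length_eq_zero_iff.1 hl']
    rcases l' with _ | ⟨j, u'⟩
    · rw [h, ← hl'] at hl
      simp at hl
    rw [List.length_cons] at hl hl' hn
    have tail : ∀ {k : Fin (r - 1)} {t : List (Fin (r - 1))},
        t.length + 1 = inv (wordProd (k :: t)) →
        wordProd t = simpleRefl k * wordProd (k :: t) ∧ t.length = inv (wordProd t) ∧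
          ¬ Asc k (wordProd (k :: t)) := by
      intro k t ht
      have hle := inv_wordProd_le t
      rw [wordProd_cons] at ht ⊢
      have := inv_simpleRefl_mul_le k (wordProd t)
      refine ⟨by simp, by omega, ?_⟩
      rw [asc_simpleRefl_mul, not_not]
      by_contra hc
      have := inv_of_not_asc hc
      omega
    obtain ⟨p1, p2, p3⟩ := tail hl
    obtain ⟨p1', p2', p3'⟩ := tail hl'
    rw [← h] at p1' p3' hl'
    set w := wordProd (i :: u) with hw
    -- For adjacent letters both words are compared with reduced words that begin with the two
    -- sides of the braid relation.
    have adj : ∀ {i j : Fin (r - 1)} {u u' : List (Fin (r - 1))}, (i : ℕ) + 1 = j →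
        wordProd u = simpleRefl i * w → wordProd u' = simpleRefl j * w →
        u.length = inv (wordProd u) → u'.length = inv (wordProd u') →
        u.length < n → u'.length < n → ¬ Asc i w → ¬ Asc j w →
        Hecke.gen i * Hecke.word u = Hecke.gen j * Hecke.word u' := by
      intro i j u u' hij q1 q1' q2 q2' q3 q3' q4 q4'
      obtain ⟨x, hx, x1, x2, x3⟩ := exists_of_adjacent_descents hij q4 q4'
      obtain ⟨z, rfl, hz⟩ := exists_word_length_eq_inv x
      have k1 := inv_of_not_asc q4
      have k2 := inv_of_not_asc q4'
      have e1 : wordProd u = wordProd (j :: i :: z) := by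
        rw [q1, hx]; simp [mul_assoc]
      have e2 : wordProd u' = wordProd (i :: j :: z) := by
        rw [q1', hx, simpleRefl_braid hij]; simp [mul_assoc]
      rw [ih _ q3 e1 q2 (by rw [← e1, q1]; simp [hz]; omega) rfl,
        ih _ q3' e2 q2' (by rw [← e2, q1']; simp [hz]; omega) rfl]
      simp only [Hecke.word_cons, ← mul_assoc, Hecke.gen_braid hij]
    rw [Hecke.word_cons, Hecke.word_cons]
    by_cases hij : i = j
    · subst hij
      rw [ih _ (by omega) (p1.trans p1'.symm) p2 p2' rfl]
    by_cases hij1 : (i : ℕ) + 1 = j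
    · exact adj hij1 p1 p1' p2 p2' (by omega) (by omega) p3 p3'
    by_cases hij2 : (j : ℕ) + 1 = i
    · exact (adj hij2 p1' p1 p2' p2 (by omega) (by omega) p3' p3).symm
    have hfar : (i : ℕ) + 1 < j ∨ (j : ℕ) + 1 < i := by
      have := Fin.val_ne_of_ne hij
      omega
    -- For distant letters `w` has reduced words beginning with `i, j` and with `j, i`.
    obtain ⟨z, hz, hzl⟩ := exists_word_length_eq_inv (simpleRefl j * (simpleRefl i * w))
    have k1 := inv_of_not_asc p3
    have k2 := inv_of_not_asc p3'
    have k3 := inv_of_not_asc (mt (asc_simpleRefl_mul_of_far hfar).1 p3')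
    have e1 : wordProd u = wordProd (j :: z) := by
      rw [wordProd_cons, hz, simpleRefl_mul_cancel_left, p1]
    have e2 : wordProd u' = wordProd (i :: z) := by
      rw [wordProd_cons, hz, ← mul_assoc (simpleRefl j), ← simpleRefl_comm hfar, mul_assoc,
        simpleRefl_mul_cancel_left, p1']
    rw [ih _ (by omega) e1 p2 (by rw [← e1, p1]; simp [hzl]; omega) rfl,
      ih _ (by omega) e2 p2' (by rw [← e2, p1']; simp [hzl]; omega) rfl]
    simp only [Hecke.word_cons, ← mul_assoc, Hecke.gen_comm hfar]

theorem Hecke.word_eq_T {l : List (Fin (r - 1))} (hl : l.length = inv (wordProd l)) :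
    Hecke.word l = Hecke.T (wordProd l) :=
  Hecke.word_eq_word (wordProd_reducedWord _).symm hl
    (by rw [wordProd_reducedWord, length_reducedWord])

theorem Hecke.T_one : Hecke.T (1 : Equiv.Perm (Fin r)) = 1 :=
  (Hecke.word_eq_T (l := []) (by simp)).symm

theorem Hecke.gen_mul_T_of_asc {i : Fin (r - 1)} {w : Equiv.Perm (Fin r)} (h : Asc i w) :
    Hecke.gen i * Hecke.T w = Hecke.T (simpleRefl i * w) := by
  have := Hecke.word_eq_T (l := i :: reducedWord w) (by
    rw [List.length_cons, length_reducedWord, wordProd_cons, wordProd_reducedWord, inv_of_asc h])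
  rwa [wordProd_cons, wordProd_reducedWord, Hecke.word_cons] at this

theorem Hecke.T_mul_gen_of_lt {i : Fin (r - 1)} {w : Equiv.Perm (Fin r)}
    (h : w (lo i) < w (hi i)) : Hecke.T w * Hecke.gen i = Hecke.T (w * simpleRefl i) := by
  have := Hecke.word_eq_T (l := reducedWord w ++ [i]) (by
    simp [length_reducedWord, wordProd_append, wordProd_reducedWord, inv_mul_simpleRefl h])
  rw [wordProd_append, wordProd_reducedWord, Hecke.word_append] at this
  rwa [show Hecke.word [i] = Hecke.gen i by simp [Hecke.word],
    show wordProd [i] = simpleRefl i by simp] at this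

/-- `T_i` acts by the eigenvalue `v²` on `T_w + T_{s_i w}`. -/
theorem Hecke.gen_mul_T_add (i : Fin (r - 1)) (w : Equiv.Perm (Fin r)) :
    Hecke.gen i * (Hecke.T w + Hecke.T (simpleRefl i * w)) =
      v ^ 2 • (Hecke.T w + Hecke.T (simpleRefl i * w)) := by
  have key : ∀ w : Equiv.Perm (Fin r), Asc i w →
      Hecke.gen i * (Hecke.T w + Hecke.T (simpleRefl i * w)) =
        v ^ 2 • (Hecke.T w + Hecke.T (simpleRefl i * w)) := by
    intro w h
    rw [← Hecke.gen_mul_T_of_asc h, mul_add, ← mul_assoc, Hecke.gen_mul_gen, add_mul,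
      smul_mul_assoc, smul_mul_assoc, one_mul, sub_smul, one_smul, smul_add]
    abel
  by_cases h : Asc i w
  · exact key w h
  · have := key _ (asc_simpleRefl_mul.2 h)
    rwa [simpleRefl_mul_cancel_left, add_comm] at this

theorem Hecke.T_add_mul_gen (i : Fin (r - 1)) (w : Equiv.Perm (Fin r)) :
    (Hecke.T w + Hecke.T (w * simpleRefl i)) * Hecke.gen i =
      v ^ 2 • (Hecke.T w + Hecke.T (w * simpleRefl i)) := by
  have key : ∀ w : Equiv.Perm (Fin r), w (lo i) < w (hi i) →
      (Hecke.T w + Hecke.T (w * simpleRefl i)) * Hecke.gen i =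
        v ^ 2 • (Hecke.T w + Hecke.T (w * simpleRefl i)) := by
    intro w h
    rw [← Hecke.T_mul_gen_of_lt h, add_mul, mul_assoc, Hecke.gen_mul_gen, mul_add,
      mul_smul_comm, mul_smul_comm, mul_one, sub_smul, one_smul, smul_add]
    abel
  rcases lt_or_gt_of_ne (w.injective.ne (lo_ne_hi i)) with h | h
  · exact key w h
  · have := key (w * simpleRefl i) (by simpa using h)
    rwa [simpleRefl_mul_cancel_right, add_comm] at this

theorem smul_two_cancel {M : Type*} [AddCommGroup M] [Module Qv M] {a b : M}
    (h : a + a = b + b) : a = b := by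
  rw [← two_smul Qv a, ← two_smul Qv b] at h
  exact smul_right_injective M (two_ne_zero (α := Qv)) h

theorem Hecke.gen_mul_sum_T {i : Fin (r - 1)} {S : Finset (Equiv.Perm (Fin r))}
    (hS : ∀ w ∈ S, simpleRefl i * w ∈ S) :
    Hecke.gen i * ∑ w ∈ S, Hecke.T w = v ^ 2 • ∑ w ∈ S, Hecke.T w := by
  have hsum : ∑ w ∈ S, Hecke.T (simpleRefl i * w) = ∑ w ∈ S, Hecke.T w :=
    Finset.sum_bij' (fun w _ => simpleRefl i * w) (fun w _ => simpleRefl i * w) hS hS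
      (by simp) (by simp) (by simp)
  apply smul_two_cancel
  nth_rewrite 2 [← hsum]
  nth_rewrite 3 [← hsum]
  rw [← mul_add, ← smul_add, ← Finset.sum_add_distrib, Finset.mul_sum, Finset.smul_sum]
  exact Finset.sum_congr rfl fun w _ => Hecke.gen_mul_T_add i w

theorem Hecke.sum_T_mul_gen {i : Fin (r - 1)} {S : Finset (Equiv.Perm (Fin r))}
    (hS : ∀ w ∈ S, w * simpleRefl i ∈ S) :
    (∑ w ∈ S, Hecke.T w) * Hecke.gen i = v ^ 2 • ∑ w ∈ S, Hecke.T w := by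
  have hsum : ∑ w ∈ S, Hecke.T (w * simpleRefl i) = ∑ w ∈ S, Hecke.T w :=
    Finset.sum_bij' (fun w _ => w * simpleRefl i) (fun w _ => w * simpleRefl i) hS hS
      (by simp) (by simp) (by simp)
  apply smul_two_cancel
  nth_rewrite 2 [← hsum]
  nth_rewrite 3 [← hsum]
  rw [← add_mul, ← smul_add, ← Finset.sum_add_distrib, Finset.sum_mul, Finset.smul_sum]
  exact Finset.sum_congr rfl fun w _ => Hecke.T_add_mul_gen i w

end HeckeMul

/-! ### The regular representation and linear independence of the `T_w` -/

section Regular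

variable {r : ℕ}

/-- The coefficients `(a, b)` of `T_i T_w = a T_w + b T_{s_i w}`, as a function of whether the
multiplication by `s_i` increases the length. -/
def structCoeff (p : Prop) [Decidable p] : Qv × Qv :=
  if p then (0, 1) else (v ^ 2 - 1, v ^ 2)

/-- Left multiplication by `T_i` on the vector space with basis the permutations. -/
def leftOp (i : Fin (r - 1)) : Module.End Qv (Equiv.Perm (Fin r) →₀ Qv) :=
  Finsupp.linearCombination Qv fun w =>
    Finsupp.single w (structCoeff (Asc i w)).1 +
      Finsupp.single (simpleRefl i * w) (structCoeff (Asc i w)).2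

/-- Right multiplication by `T_i` on the vector space with basis the permutations. -/
def rightOp (i : Fin (r - 1)) : Module.End Qv (Equiv.Perm (Fin r) →₀ Qv) :=
  Finsupp.linearCombination Qv fun w =>
    Finsupp.single w (structCoeff (w (lo i) < w (hi i))).1 +
      Finsupp.single (w * simpleRefl i) (structCoeff (w (lo i) < w (hi i))).2

theorem leftOp_single (i : Fin (r - 1)) (w : Equiv.Perm (Fin r)) (c : Qv) :
    leftOp i (Finsupp.single w c) =
      Finsupp.single w (c * (structCoeff (Asc i w)).1) +
      Finsupp.single (simpleRefl i * w) (c * (structCoeff (Asc i w)).2) := by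
  simp [leftOp, Finsupp.smul_single]

theorem rightOp_single (i : Fin (r - 1)) (w : Equiv.Perm (Fin r)) (c : Qv) :
    rightOp i (Finsupp.single w c) =
      Finsupp.single w (c * (structCoeff (w (lo i) < w (hi i))).1) +
      Finsupp.single (w * simpleRefl i) (c * (structCoeff (w (lo i) < w (hi i))).2) := by
  simp [rightOp, Finsupp.smul_single]

theorem leftOp_of_asc {i : Fin (r - 1)} {w : Equiv.Perm (Fin r)} (h : Asc i w) (c : Qv) :
    leftOp i (Finsupp.single w c) = Finsupp.single (simpleRefl i * w) c := by
  simp [leftOp_single, structCoeff, h]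

theorem leftOp_of_not_asc {i : Fin (r - 1)} {w : Equiv.Perm (Fin r)} (h : ¬ Asc i w) (c : Qv) :
    leftOp i (Finsupp.single w c) = Finsupp.single w (c * (v ^ 2 - 1)) +
      Finsupp.single (simpleRefl i * w) (c * v ^ 2) := by
  simp [leftOp_single, structCoeff, h]

theorem structCoeff_congr {p q : Prop} [Decidable p] [Decidable q] (h : p ↔ q) :
    structCoeff p = structCoeff q := by
  simp [structCoeff, h]

theorem simpleRefl_lt_iff {i : Fin (r - 1)} {a b : Fin r} (h1 : ¬(a = lo i ∧ b = hi i))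
    (h2 : ¬(a = hi i ∧ b = lo i)) : simpleRefl i a < simpleRefl i b ↔ a < b := by
  refine ⟨fun h => ?_, fun h => simpleRefl_lt h h1⟩
  have := simpleRefl_lt (i := i) h fun hc => h2 ⟨?_, ?_⟩
  · simpa using this
  · rw [← simpleRefl_simpleRefl i a, hc.1, simpleRefl_lo]
  · rw [← simpleRefl_simpleRefl i b, hc.2, simpleRefl_hi]

theorem simpleRefl_mul_eq_of_map {i j : Fin (r - 1)} {w : Equiv.Perm (Fin r)}
    (h : w (lo j) = lo i ∧ w (hi j) = hi i ∨ w (lo j) = hi i ∧ w (hi j) = lo i) :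
    simpleRefl i * w = w * simpleRefl j := by
  rw [simpleRefl_eq_swap j, Equiv.mul_swap_eq_swap_mul, simpleRefl_eq_swap i]
  rcases h with ⟨h1, h2⟩ | ⟨h1, h2⟩ <;> rw [h1, h2]
  rw [Equiv.swap_comm]

/-- If `s_i w = w s_j`, then `s_i` lengthens `w` on the left iff `s_j` does so on the right. -/
theorem asc_iff_of_eq {i j : Fin (r - 1)} {w : Equiv.Perm (Fin r)}
    (h : simpleRefl i * w = w * simpleRefl j) : Asc i w ↔ w (lo j) < w (hi j) := by
  have e : simpleRefl i (w (lo j)) = w (hi j) := by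
    rw [← Equiv.Perm.mul_apply, h, Equiv.Perm.mul_apply, simpleRefl_lo]
  have k : ∀ x, w⁻¹ (w x) = x := fun x => by simp
  by_cases h1 : w (lo j) = lo i
  · rw [h1, simpleRefl_lo] at e
    rw [Asc, h1, ← e, ← h1, k, h1, e, k, ← e]
    exact iff_of_true (lo_lt_hi j) (lo_lt_hi i)
  by_cases h2 : w (lo j) = hi i
  · rw [h2, simpleRefl_hi] at e
    rw [Asc, h2, ← e, ← h2, k, h2, e, k, ← e]
    exact iff_of_false (lo_lt_hi j).asymm (lo_lt_hi i).asymm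
  rw [simpleRefl_of_ne h1 h2] at e
  exact absurd (w.injective e) (lo_ne_hi j)

theorem asc_mul_iff_of_ne {i j : Fin (r - 1)} {w : Equiv.Perm (Fin r)}
    (h : simpleRefl i * w ≠ w * simpleRefl j) : Asc i (w * simpleRefl j) ↔ Asc i w := by
  rw [Asc, mul_inv_rev, simpleRefl_inv, Equiv.Perm.mul_apply, Equiv.Perm.mul_apply]
  refine simpleRefl_lt_iff (fun hc => h (simpleRefl_mul_eq_of_map (.inl ?_)))
    (fun hc => h (simpleRefl_mul_eq_of_map (.inr ?_)))
  · rw [← hc.1, ← hc.2]; simp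
  · rw [← hc.1, ← hc.2]; simp

theorem mul_lt_iff_of_ne {i j : Fin (r - 1)} {w : Equiv.Perm (Fin r)}
    (h : simpleRefl i * w ≠ w * simpleRefl j) :
    (simpleRefl i * w) (lo j) < (simpleRefl i * w) (hi j) ↔ w (lo j) < w (hi j) := by
  rw [Equiv.Perm.mul_apply, Equiv.Perm.mul_apply]
  exact simpleRefl_lt_iff (fun hc => h (simpleRefl_mul_eq_of_map (.inl hc)))
    (fun hc => h (simpleRefl_mul_eq_of_map (.inr hc)))

theorem leftOp_comm_rightOp (i j : Fin (r - 1)) : Commute (leftOp i) (rightOp j) := by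
  refine Finsupp.lhom_ext fun w c => ?_
  simp only [Module.End.mul_apply, leftOp_single, rightOp_single, map_add]
  by_cases h : simpleRefl i * w = w * simpleRefl j
  · have h' : simpleRefl i * (simpleRefl i * w) = simpleRefl i * w * simpleRefl j := by
      rw [simpleRefl_mul_cancel_left, h, simpleRefl_mul_cancel_right]
    rw [← structCoeff_congr (asc_iff_of_eq h), ← h, ← structCoeff_congr (asc_iff_of_eq h'), ← h']
  · rw [structCoeff_congr (asc_mul_iff_of_ne h), structCoeff_congr (mul_lt_iff_of_ne h),
      mul_assoc (simpleRefl i)]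
    ring_nf
    abel

/-- The basis vector of the trivial permutation generates under right multiplications, so an
operator that commutes with them is determined by its value there. -/
theorem eq_of_commute_rightOp {X Y : Module.End Qv (Equiv.Perm (Fin r) →₀ Qv)}
    (hX : ∀ j, Commute X (rightOp j)) (hY : ∀ j, Commute Y (rightOp j))
    (h : X (Finsupp.single 1 1) = Y (Finsupp.single 1 1)) : X = Y := by
  have key : ∀ w : Equiv.Perm (Fin r), X (Finsupp.single w 1) = Y (Finsupp.single w 1) := by
    intro w
    induction hn : inv w using Nat.strong_induction_on generalizing w with
    | _ n ih =>
      by_cases hw : ∀ i, Asc i w⁻¹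
      · rw [inv_eq_one.1 (eq_one_of_forall_asc hw), h]
      · push Not at hw
        obtain ⟨i, hd⟩ := hw
        have hlt : (w * simpleRefl i) (lo i) < (w * simpleRefl i) (hi i) := by
          simpa [not_asc] using hd
        have h1 := inv_mul_simpleRefl hlt
        rw [simpleRefl_mul_cancel_right] at h1
        have h2 : rightOp i (Finsupp.single (w * simpleRefl i) 1) = Finsupp.single w 1 := by
          rw [rightOp_single, structCoeff, if_pos hlt]
          simp
        rw [← h2, ← Module.End.mul_apply, ← Module.End.mul_apply, hX i, hY i,
          Module.End.mul_apply, Module.End.mul_apply, ih _ (by omega) _ rfl]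
  refine Finsupp.lhom_ext fun w c => ?_
  rw [← mul_one c, ← smul_eq_mul, ← Finsupp.smul_single, map_smul, map_smul, key]

/-- The regular representation of the Hecke algebra. -/
def regRep (r : ℕ) : Hecke r →ₐ[Qv] Module.End Qv (Equiv.Perm (Fin r) →₀ Qv) :=
  RingQuot.liftAlgHom Qv ⟨FreeAlgebra.lift Qv leftOp, by
    have hc := fun i j : Fin (r - 1) => leftOp_comm_rightOp i j
    have asc_one : ∀ i : Fin (r - 1), Asc i 1 := fun i => by simpa [Asc] using lo_lt_hi i
    intro x y h
    induction h with
    | quad i =>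
      simp only [map_mul, map_add, map_sub, map_one, map_zero, FreeAlgebra.lift_ι_apply,
        AlgHom.commutes]
      refine eq_of_commute_rightOp (fun j => ?_) (fun j => Commute.zero_left _) ?_
      · exact ((hc i j).add_left (Commute.one_left _)).mul_left
          (Commute.sub_left (R := Module.End Qv (Equiv.Perm (Fin r) →₀ Qv)) (hc i j)
            (Algebra.commute_algebraMap_left _ _))
      · have hn : ¬ Asc i (simpleRefl i) := by
          rw [← mul_one (simpleRefl i), asc_simpleRefl_mul, not_not]; exact asc_one i
        simp only [Module.End.mul_apply, LinearMap.add_apply, LinearMap.sub_apply, mul_one,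
          Module.End.one_apply, Module.algebraMap_end_apply, leftOp_of_asc (asc_one i), map_sub,
          leftOp_of_not_asc hn, simpleRefl_mul_self, LinearMap.zero_apply,
          Finsupp.smul_single, smul_eq_mul, one_mul, Finsupp.single_sub]
        abel
    | braid i j h =>
      simp only [map_mul, FreeAlgebra.lift_ι_apply]
      refine eq_of_commute_rightOp (fun k => ?_) (fun k => ?_) ?_
      · exact ((hc i k).mul_left (hc j k)).mul_left (hc i k)
      · exact ((hc j k).mul_left (hc i k)).mul_left (hc j k)
      · have e1 : hi i = lo j := Fin.ext h
        have e2 : simpleRefl i (hi j) = hi j :=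
          simpleRefl_of_ne (by simp [lo, hi, Fin.ext_iff]; omega)
            (by simp [hi, Fin.ext_iff]; omega)
        have e3 : simpleRefl j (lo i) = lo i :=
          simpleRefl_of_ne (by simp [lo, Fin.ext_iff]; omega)
            (by simp [lo, hi, Fin.ext_iff]; omega)
        have e4 : simpleRefl i (lo j) = lo i := by rw [← e1, simpleRefl_hi]
        have e5 : simpleRefl j (hi i) = hi j := by rw [e1, simpleRefl_lo]
        have hij : lo i < hi j := by simp [lo, hi, Fin.lt_def]; omega
        have a1 : Asc j (simpleRefl i * 1) := by simpa [Asc, e2, e4] using hij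
        have a2 : Asc i (simpleRefl j * 1) := by simpa [Asc, e3, e5] using hij
        have a3 : Asc i (simpleRefl j * (simpleRefl i * 1)) := by
          simpa [Asc, e2, e3, e5, e1] using lo_lt_hi j
        have a4 : Asc j (simpleRefl i * (simpleRefl j * 1)) := by
          simpa [Asc, e2, e3, e4, ← e1] using lo_lt_hi i
        simp only [Module.End.mul_apply]
        rw [leftOp_of_asc (asc_one i), leftOp_of_asc a1, leftOp_of_asc a3,
          leftOp_of_asc (asc_one j), leftOp_of_asc a2, leftOp_of_asc a4]
        simp only [← mul_assoc, simpleRefl_braid h]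
    | comm i j h =>
      simp only [map_mul, FreeAlgebra.lift_ι_apply]
      refine eq_of_commute_rightOp (fun k => (hc i k).mul_left (hc j k))
        (fun k => (hc j k).mul_left (hc i k)) ?_
      simp only [Module.End.mul_apply]
      rw [leftOp_of_asc (asc_one i), leftOp_of_asc (asc_one j),
        leftOp_of_asc ((asc_simpleRefl_mul_of_far h).2 (asc_one j)),
        leftOp_of_asc ((asc_simpleRefl_mul_of_far h.symm).2 (asc_one i)),
        ← mul_assoc, ← mul_assoc, simpleRefl_comm h]⟩

theorem regRep_gen (i : Fin (r - 1)) : regRep r (Hecke.gen i) = leftOp i := by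
  rw [regRep, Hecke.gen]
  erw [RingQuot.liftAlgHom_mkAlgHom_apply]
  rw [FreeAlgebra.lift_ι_apply]

theorem regRep_T (w : Equiv.Perm (Fin r)) :
    regRep r (Hecke.T w) (Finsupp.single 1 1) = Finsupp.single w 1 := by
  induction hn : inv w using Nat.strong_induction_on generalizing w with
  | _ n ih =>
    by_cases hw : ∀ i, Asc i w
    · obtain rfl := eq_one_of_forall_asc hw
      rw [Hecke.T_one, map_one, Module.End.one_apply]
    · push Not at hw
      obtain ⟨i, hd⟩ := hw
      have h1 := inv_of_not_asc hd
      have h2 := asc_simpleRefl_mul.2 hd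
      rw [← simpleRefl_mul_cancel_left i w, ← Hecke.gen_mul_T_of_asc h2, map_mul,
        Module.End.mul_apply, ih _ (by omega) _ rfl, regRep_gen, leftOp_of_asc h2]

/-- The coefficient of `T_w` in an element of the Hecke algebra. -/
def Hecke.coeff (w : Equiv.Perm (Fin r)) : Hecke r →ₗ[Qv] Qv :=
  (Finsupp.lapply w).comp ((LinearMap.applyₗ (Finsupp.single 1 1)).comp (regRep r).toLinearMap)

theorem Hecke.coeff_T (w x : Equiv.Perm (Fin r)) :
    Hecke.coeff w (Hecke.T x) = if x = w then 1 else 0 := by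
  simp [Hecke.coeff, regRep_T, Finsupp.single_apply]

end Regular

/-! ### Blocks, Young subgroups and relative position matrices -/

section Blocks

variable {n r : ℕ}

/-- The number of letters in the blocks before the block with index `k`. -/
def startAt (l : Comp n r) (k : Fin n) : ℕ := ∑ t ∈ Finset.univ.filter (· < k), l.1 t

theorem mem_block {l : Comp n r} {k : Fin n} {x : Fin r} :
    x ∈ block l k ↔ startAt l k ≤ x ∧ (x : ℕ) < startAt l k + l.1 k := by
  simp [block, startAt]

theorem startAt_add_le {l : Comp n r} {k k' : Fin n} (h : k < k') :
    startAt l k + l.1 k ≤ startAt l k' := by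
  rw [startAt, add_comm, ← Finset.sum_insert (s := Finset.univ.filter (· < k)) (by simp)]
  refine Finset.sum_le_sum_of_subset fun t ht => ?_
  rcases Finset.mem_insert.1 ht with rfl | ht
  · simpa using h
  · simp only [Finset.mem_filter, Finset.mem_univ, true_and] at ht ⊢
    exact ht.trans h

theorem lt_of_mem_block {l : Comp n r} {k k' : Fin n} (h : k < k') {x y : Fin r}
    (hx : x ∈ block l k) (hy : y ∈ block l k') : x < y := by
  rw [mem_block] at hx hy
  have := startAt_add_le (l := l) h
  rw [Fin.lt_def]
  omega

theorem eq_of_mem_block {l : Comp n r} {k k' : Fin n} {x : Fin r}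
    (hx : x ∈ block l k) (hy : x ∈ block l k') : k = k' := by
  rcases lt_trichotomy k k' with h | h | h
  · exact absurd (lt_of_mem_block h hx hy) (lt_irrefl _)
  · exact h
  · exact absurd (lt_of_mem_block h hy hx) (lt_irrefl _)

theorem startAt_add_le_total (l : Comp n r) (k : Fin n) : startAt l k + l.1 k ≤ r := by
  rw [startAt, add_comm, ← Finset.sum_insert (s := Finset.univ.filter (· < k)) (by simp)]
  exact (Finset.sum_le_sum_of_subset (Finset.subset_univ _)).trans l.2.le

theorem card_block (l : Comp n r) (k : Fin n) : (block l k).card = l.1 k := by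
  have h : (block l k).map Fin.valEmbedding =
      Finset.Ico (startAt l k) (startAt l k + l.1 k) := by
    ext x
    simp only [Finset.mem_map, mem_block, Fin.valEmbedding_apply, Finset.mem_Ico]
    constructor
    · rintro ⟨y, hy, rfl⟩; exact hy
    · intro hx
      exact ⟨⟨x, hx.2.trans_le (startAt_add_le_total l k)⟩, hx, rfl⟩
  rw [← Finset.card_map Fin.valEmbedding, h, Nat.card_Ico, Nat.add_sub_cancel_left]

theorem exists_mem_block (l : Comp n r) (x : Fin r) : ∃ k, x ∈ block l k := by
  have hd : ((Finset.univ : Finset (Fin n)) : Set (Fin n)).PairwiseDisjoint (block l) :=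
    fun k _ k' _ hk => Finset.disjoint_left.2 fun y hy hy' => hk (eq_of_mem_block hy hy')
  have h : Finset.univ.biUnion (block l) = Finset.univ := by
    rw [← Finset.card_eq_iff_eq_univ, Finset.card_biUnion hd]
    simp [card_block, l.2]
  have := Finset.mem_univ x
  rw [← h] at this
  simpa using this

/-- The index of the block that contains a letter. -/
def blockIndex (l : Comp n r) (x : Fin r) : Fin n := (exists_mem_block l x).choose

theorem mem_block_iff {l : Comp n r} {x : Fin r} {k : Fin n} :
    x ∈ block l k ↔ blockIndex l x = k :=
  ⟨fun h => eq_of_mem_block (exists_mem_block l x).choose_spec h,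
    fun h => h ▸ (exists_mem_block l x).choose_spec⟩

theorem mem_young_iff {l : Comp n r} {w : Equiv.Perm (Fin r)} :
    w ∈ young l ↔ ∀ x, blockIndex l (w x) = blockIndex l x := by
  constructor
  · exact fun h x => mem_block_iff.1 ((h _ x).2 (mem_block_iff.2 rfl))
  · intro h k x
    rw [mem_block_iff, mem_block_iff, h]

/-- A left descent of an element of a Young subgroup is a simple transposition in that subgroup,
since an element of the subgroup keeps the order of letters from distinct blocks. -/
theorem simpleRefl_mem_young {l : Comp n r} {w : Equiv.Perm (Fin r)} (hw : w ∈ young l)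
    {i : Fin (r - 1)} (hi : ¬ Asc i w) : simpleRefl i ∈ young l := by
  have hw' := mem_young_iff.1 (inv_mem hw)
  have hle : ∀ {a b : Fin r}, a < b → blockIndex l a ≤ blockIndex l b := by
    intro a b hab
    by_contra hc
    exact lt_asymm hab (lt_of_mem_block (not_le.1 hc) (mem_block_iff.2 rfl) (mem_block_iff.2 rfl))
  have h1 := hle (lo_lt_hi i)
  have h2 := hle (not_asc.1 hi)
  rw [hw', hw'] at h2
  have h := le_antisymm h1 h2
  rw [mem_young_iff]
  intro x
  by_cases hx : x = lo i
  · rw [hx, simpleRefl_lo, h]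
  by_cases hx' : x = BLM.hi i
  · rw [hx', simpleRefl_hi, h]
  rw [simpleRefl_of_ne hx hx']

theorem relMatrix_apply (l m : Comp n r) (d : Equiv.Perm (Fin r)) (i j : Fin n) :
    relMatrix l m d i j =
      (Finset.univ.filter fun x => blockIndex m x = j ∧ blockIndex l (d x) = i).card := by
  rw [relMatrix, eq_comm, ← Finset.card_map d.toEmbedding]
  congr 1
  ext x
  simp only [Finset.mem_inter, Finset.mem_image, Finset.mem_map, Finset.mem_filter,
    Finset.mem_univ, true_and, mem_block_iff, Equiv.coe_toEmbedding]
  constructor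
  · rintro ⟨y, ⟨h2, h1⟩, rfl⟩; exact ⟨h1, y, h2, rfl⟩
  · rintro ⟨h1, y, h2, rfl⟩; exact ⟨y, ⟨h2, h1⟩, rfl⟩

theorem relMatrix_eq_of_mem {l m : Comp n r} {d w : Equiv.Perm (Fin r)}
    (h : w ∈ DoubleCoset.doubleCoset d (young l : Set (Equiv.Perm (Fin r))) (young m)) :
    relMatrix l m w = relMatrix l m d := by
  obtain ⟨a, ha, b, hb, rfl⟩ := DoubleCoset.mem_doubleCoset.1 h
  have ha' := mem_young_iff.1 ha
  have hb' := mem_young_iff.1 hb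
  ext i j
  rw [relMatrix_apply, relMatrix_apply, ← Finset.card_map b.toEmbedding]
  congr 1
  ext x
  simp only [Finset.mem_map, Finset.mem_filter, Finset.mem_univ, true_and,
    Equiv.coe_toEmbedding, Equiv.Perm.mul_apply, ha']
  constructor
  · rintro ⟨y, ⟨h1, h2⟩, rfl⟩
    exact ⟨by rw [hb', h1], h2⟩
  · rintro ⟨h1, h2⟩
    refine ⟨b⁻¹ x, ⟨?_, ?_⟩, by simp⟩
    · rw [← hb']; simpa using h1
    · simpa using h2

/-- Two maps to the same set whose fibres have the same sizes differ by a bijection. -/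
theorem exists_equiv_of_card_fiber {α β γ : Type*} [Fintype α] [Fintype β] [DecidableEq γ]
    (f : α → γ) (g : β → γ)
    (h : ∀ c, (Finset.univ.filter (f · = c)).card = (Finset.univ.filter (g · = c)).card) :
    ∃ e : α ≃ β, ∀ a, g (e a) = f a := by
  have e : ∀ c, { a // f a = c } ≃ { b // g b = c } := fun c =>
    Fintype.equivOfCardEq (by rw [Fintype.card_subtype, Fintype.card_subtype, h])
  exact ⟨Equiv.ofFiberEquiv e, Equiv.ofFiberEquiv_map e⟩

/-- Every matrix occurs as the relative position matrix of some permutation. -/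
theorem exists_relMatrix_eq (A : Theta n r) : ∃ w, relMatrix (ro A) (co A) w = A.1 := by
  let E := Σ p : Fin n × Fin n, Fin (A.1 p.1 p.2)
  have hcard : ∀ (l : Comp n r) (k : Fin n),
      (Finset.univ.filter (blockIndex l · = k)).card = l.1 k := by
    intro l k
    rw [← card_block l k]
    congr 1
    ext x
    simp [mem_block_iff]
  have hE : ∀ P : Fin n × Fin n → Prop, ∀ [DecidablePred P],
      (Finset.univ.filter (fun x : E => P x.1)).card =
        ∑ p, if P p then A.1 p.1 p.2 else 0 := by
    intro P _
    rw [Finset.card_filter, Fintype.sum_sigma]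
    refine Finset.sum_congr rfl fun p _ => ?_
    split_ifs <;> simp
  obtain ⟨f, hf⟩ := exists_equiv_of_card_fiber (fun x : E => x.1.1) (blockIndex (ro A)) (by
    intro c
    rw [hcard, hE (fun p => p.1 = c), Fintype.sum_prod_type]
    simp [ro, Finset.sum_ite_irrel])
  obtain ⟨g, hg⟩ := exists_equiv_of_card_fiber (fun x : E => x.1.2) (blockIndex (co A)) (by
    intro c
    rw [hcard, hE (fun p => p.2 = c), Fintype.sum_prod_type]
    simp [co])
  refine ⟨g.symm.trans f, ?_⟩
  ext i j
  rw [relMatrix_apply, ← Finset.card_map g.symm.toEmbedding]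
  have : (Finset.univ.filter fun x => blockIndex (co A) x = j ∧
      blockIndex (ro A) ((g.symm.trans f) x) = i).map g.symm.toEmbedding =
      Finset.univ.filter (fun x : E => x.1 = (i, j)) := by
    ext x
    simp only [Finset.mem_map_equiv, Finset.mem_filter, Finset.mem_univ, true_and,
      Equiv.symm_symm, Equiv.trans_apply, Equiv.symm_apply_apply, hf, hg, Prod.ext_iff]
    exact and_comm
  rw [this, hE (fun p => p = (i, j))]
  simp

/-- An element of minimal length in the double coset of a permutation with matrix `A`. -/
theorem exists_distinguished (A : Theta n r) :
    ∃ d, IsDistinguished (ro A) (co A) d ∧ relMatrix (ro A) (co A) d = A.1 := by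
  obtain ⟨w, hw⟩ := exists_relMatrix_eq A
  obtain ⟨d, hd, hmin⟩ := exists_minimalFor_of_wellFoundedLT
    (fun d => d ∈ DoubleCoset.doubleCoset w (young (ro A) : Set (Equiv.Perm (Fin r)))
      (young (co A))) length ⟨w, DoubleCoset.mem_doubleCoset_self _ _ _⟩
  refine ⟨d, fun x hx => ?_, (relMatrix_eq_of_mem hd).trans hw⟩
  rw [DoubleCoset.doubleCoset_eq_of_mem hd] at hx
  exact (le_total _ _).elim id (hmin hx)

/-- If the relative position matrix is diagonal, then the permutation preserves the blocks. -/
theorem mem_young_of_relMatrix {l : Comp n r} {d : Equiv.Perm (Fin r)}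
    (h : ∀ i j, i ≠ j → relMatrix l l d i j = 0) : d ∈ young l := by
  rw [mem_young_iff]
  intro x
  by_contra hx
  have := h _ _ hx
  rw [relMatrix_apply, Finset.card_eq_zero, Finset.filter_eq_empty_iff] at this
  exact this (Finset.mem_univ x) ⟨rfl, rfl⟩

end Blocks

/-! ### The generators of the permutation modules -/

section PermMod

variable {n r : ℕ}

open Classical in
/-- The Poincaré polynomial `∑ v^(2 ℓ(w))` of a Young subgroup. -/
def poincare (l : Comp n r) : Qv := ∑ w ∈ Finset.univ.filter (· ∈ young l), (v ^ 2) ^ inv w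

/-- The Poincaré polynomial is non-zero as its value at `v = 1` is the order of the subgroup. -/
theorem poincare_ne_zero (l : Comp n r) : poincare l ≠ 0 := by
  classical
  have h : poincare l = algebraMap (Polynomial ℚ) Qv
      (∑ w ∈ Finset.univ.filter (· ∈ young l), (Polynomial.X ^ 2) ^ inv w) := by
    rw [poincare, map_sum]
    refine Finset.sum_congr rfl fun w _ => ?_
    rw [map_pow, map_pow, RatFunc.algebraMap_X, v]
  rw [h, Ne, map_eq_zero_iff _ (RatFunc.algebraMap_injective ℚ)]
  intro hc
  have h1 := congrArg (Polynomial.eval 1) hc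
  simp only [Polynomial.eval_finsetSum, Polynomial.eval_pow, Polynomial.eval_X, one_pow,
    Finset.sum_const, nsmul_eq_mul, mul_one, Polynomial.eval_zero, Nat.cast_eq_zero,
    Finset.card_eq_zero, Finset.filter_eq_empty_iff] at h1
  exact h1 (Finset.mem_univ 1) (one_mem _)

/-- A common eigenvector of the `T_i` in a Young subgroup, for the eigenvalue `v²`, is one of all
`T_w` in that subgroup. -/
theorem Hecke.T_mul_of_eigen {l : Comp n r} {h : Hecke r}
    (hh : ∀ i, simpleRefl i ∈ young l → Hecke.gen i * h = v ^ 2 • h)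
    {w : Equiv.Perm (Fin r)} (hw : w ∈ young l) : Hecke.T w * h = (v ^ 2) ^ inv w • h := by
  induction hn : inv w using Nat.strong_induction_on generalizing w with
  | _ k ih =>
    by_cases hd : ∀ i, Asc i w
    · obtain rfl := eq_one_of_forall_asc hd
      rw [inv_one] at hn
      rw [Hecke.T_one, one_mul, ← hn, pow_zero, one_smul]
    · push Not at hd
      obtain ⟨i, hd⟩ := hd
      have h1 := inv_of_not_asc hd
      have hs := simpleRefl_mem_young hw hd
      rw [← simpleRefl_mul_cancel_left i w, ← Hecke.gen_mul_T_of_asc (asc_simpleRefl_mul.2 hd),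
        mul_assoc, ih _ (by omega) (mul_mem hs hw) rfl, mul_smul_comm, hh i hs, smul_smul,
        ← pow_succ, ← h1, hn]

theorem Hecke.mul_T_of_eigen {l : Comp n r} {h : Hecke r}
    (hh : ∀ i, simpleRefl i ∈ young l → h * Hecke.gen i = v ^ 2 • h)
    {w : Equiv.Perm (Fin r)} (hw : w ∈ young l) : h * Hecke.T w = (v ^ 2) ^ inv w • h := by
  induction hn : inv w using Nat.strong_induction_on generalizing w with
  | _ k ih =>
    by_cases hd : ∀ i, Asc i w⁻¹
    · rw [inv_eq_one.1 (eq_one_of_forall_asc hd)] at hn ⊢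
      rw [inv_one] at hn
      rw [Hecke.T_one, mul_one, ← hn, pow_zero, one_smul]
    · push Not at hd
      obtain ⟨i, hd⟩ := hd
      have hs := simpleRefl_mem_young (inv_mem hw) hd
      have hlt : (w * simpleRefl i) (lo i) < (w * simpleRefl i) (hi i) := by
        simpa [not_asc] using hd
      have h1 := inv_mul_simpleRefl hlt
      rw [simpleRefl_mul_cancel_right] at h1
      rw [← simpleRefl_mul_cancel_right i w, ← Hecke.T_mul_gen_of_lt hlt,
        ← mul_assoc, ih _ (by omega) (mul_mem hw hs) rfl, smul_mul_assoc, hh i hs, smul_smul,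
        ← pow_succ, ← h1, hn]

theorem xElt_mul_of_eigen {l : Comp n r} {h : Hecke r}
    (hh : ∀ i, simpleRefl i ∈ young l → Hecke.gen i * h = v ^ 2 • h) :
    xElt l * h = poincare l • h := by
  classical
  rw [xElt, poincare, Finset.sum_mul, Finset.sum_smul]
  exact Finset.sum_congr rfl fun w hw => Hecke.T_mul_of_eigen hh (Finset.mem_filter.1 hw).2

theorem mul_xElt_of_eigen {l : Comp n r} {h : Hecke r}
    (hh : ∀ i, simpleRefl i ∈ young l → h * Hecke.gen i = v ^ 2 • h) :
    h * xElt l = poincare l • h := by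
  classical
  rw [xElt, poincare, Finset.mul_sum, Finset.sum_smul]
  exact Finset.sum_congr rfl fun w hw => Hecke.mul_T_of_eigen hh (Finset.mem_filter.1 hw).2

theorem xElt_mul_dcSum (l m : Comp n r) (d : Equiv.Perm (Fin r)) :
    xElt l * dcSum l m d = poincare l • dcSum l m d := by
  classical
  refine xElt_mul_of_eigen fun i hi => Hecke.gen_mul_sum_T fun w hw => ?_
  simp only [Finset.mem_filter, Finset.mem_univ, true_and] at hw ⊢
  obtain ⟨a, ha, b, hb, rfl⟩ := DoubleCoset.mem_doubleCoset.1 hw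
  exact DoubleCoset.mem_doubleCoset.2
    ⟨simpleRefl i * a, mul_mem hi ha, b, hb, by simp only [mul_assoc]⟩

theorem dcSum_mul_xElt (l m : Comp n r) (d : Equiv.Perm (Fin r)) :
    dcSum l m d * xElt m = poincare m • dcSum l m d := by
  classical
  refine mul_xElt_of_eigen fun i hi => Hecke.sum_T_mul_gen fun w hw => ?_
  simp only [Finset.mem_filter, Finset.mem_univ, true_and] at hw ⊢
  obtain ⟨a, ha, b, hb, rfl⟩ := DoubleCoset.mem_doubleCoset.1 hw
  exact DoubleCoset.mem_doubleCoset.2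
    ⟨a, ha, b * simpleRefl i, mul_mem hb hi, by simp only [mul_assoc]⟩

theorem dcSum_of_mem_young {l : Comp n r} {d : Equiv.Perm (Fin r)} (hd : d ∈ young l) :
    dcSum l l d = xElt l := by
  classical
  rw [dcSum, xElt]
  congr 1
  ext w
  simp only [Finset.mem_filter, Finset.mem_univ, true_and]
  constructor
  · intro hw
    obtain ⟨a, ha, b, hb, rfl⟩ := DoubleCoset.mem_doubleCoset.1 hw
    exact mul_mem (mul_mem ha hd) hb
  · intro hw
    exact DoubleCoset.mem_doubleCoset.2 ⟨w * d⁻¹, mul_mem hw (inv_mem hd), 1, one_mem _, by simp⟩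

end PermMod

/-! ### The elements `[A]` of the `q`-Schur algebra -/

section Schur

variable {n r : ℕ}

theorem dcSum_mul_mem (l m : Comp n r) (d : Equiv.Perm (Fin r)) (h : Hecke r) :
    dcSum l m d * h ∈ permMod l := by
  have : dcSum l m d = xElt l * ((poincare l)⁻¹ • dcSum l m d) := by
    rw [mul_smul_comm, xElt_mul_dcSum, smul_smul, inv_mul_cancel₀ (poincare_ne_zero l), one_smul]
  rw [this, mul_assoc]
  exact (xMul l _).2

/-- The map `φ_{l,m}^d`. As `∑ T_x`, `x ∈ S_l d S_m`, is an eigenvector for right multiplication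
by `x_m`, it is left multiplication by a scalar multiple of this sum. -/
theorem exists_isPhi (l m : Comp n r) (d : Equiv.Perm (Fin r)) : ∃ f, IsPhi l m d f := by
  classical
  let a : Hecke r := (poincare m)⁻¹ • dcSum l m d
  have ha : ∀ h, a * h ∈ permMod l := fun h => by
    rw [smul_mul_assoc, ← mul_smul_comm]
    exact dcSum_mul_mem l m d _
  let g : permMod m →ₗ[(Hecke r)ᵐᵒᵖ] permMod l :=
    { toFun := fun y => ⟨a * y, ha _⟩
      map_add' := fun y z => Subtype.ext (mul_add a _ _)
      map_smul' := fun c y => Subtype.ext (mul_assoc a _ _).symm }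
  refine ⟨(LinearMap.single _ _ l).comp (g.comp (LinearMap.proj m)), fun k k' h => ?_⟩
  simp only [LinearMap.comp_apply, LinearMap.proj_apply, LinearMap.coe_single]
  by_cases hk : k = m
  · subst hk
    by_cases hk' : k' = l
    · subst hk'
      rw [Pi.single_eq_same, Pi.single_eq_same, if_pos ⟨rfl, rfl⟩]
      change a * (xElt k * h) = _
      rw [← mul_assoc, smul_mul_assoc, dcSum_mul_xElt, smul_smul,
        inv_mul_cancel₀ (poincare_ne_zero k), one_smul]
    · rw [Pi.single_eq_of_ne hk', if_neg fun hc => hk' hc.2]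
      rfl
  · rw [Pi.single_eq_of_ne (Ne.symm hk), map_zero, Pi.single_zero, if_neg fun hc => hk hc.1]
    rfl

theorem phi_spec (l m : Comp n r) (d : Equiv.Perm (Fin r)) : IsPhi l m d (phi l m d) := by
  rw [phi, dif_pos (exists_isPhi l m d)]
  exact (exists_isPhi l m d).choose_spec

/-- The values of `[A]` on the generators of the summands. -/
theorem stdElt_spec (A : Theta n r) : ∃ d, relMatrix (ro A) (co A) d = A.1 ∧
    ∀ (k k' : Comp n r) (h : Hecke r),
      ((stdElt A (Pi.single k (xMul k h)) k' : permMod k') : Hecke r) =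
        if k = co A ∧ k' = ro A then v ^ (-(dA A.1 : ℤ)) • (dcSum (ro A) (co A) d * h) else 0 := by
  have hd := exists_distinguished A
  refine ⟨hd.choose, hd.choose_spec.2, fun k k' h => ?_⟩
  rw [stdElt, dif_pos hd, LinearMap.smul_apply, Pi.smul_apply]
  change v ^ (-(dA A.1 : ℤ)) • ((phi _ _ _ _ k' : permMod k') : Hecke r) = _
  rw [phi_spec, smul_ite, smul_zero]

theorem exists_xMul {k : Comp n r} (y : permMod k) : ∃ h, y = xMul k h := by
  obtain ⟨c, hc⟩ := Submodule.mem_span_singleton.1 y.2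
  exact ⟨c.unop, Subtype.ext hc.symm⟩

theorem stdElt_single_apply_of_ne (A : Theta n r) {k k' : Comp n r}
    (h : ¬(k = co A ∧ k' = ro A)) (y : permMod k) : stdElt A (Pi.single k y) k' = 0 := by
  obtain ⟨c, rfl⟩ := exists_xMul y
  obtain ⟨d, -, hd⟩ := stdElt_spec A
  exact Subtype.ext ((hd _ _ _).trans (if_neg h))

theorem stdElt_apply (A : Theta n r) (t : TensorMod n r) (k' : Comp n r) :
    stdElt A t k' = ∑ k, stdElt A (Pi.single k (t k)) k' := by
  rw [← Finset.sum_apply, ← map_sum, Finset.univ_sum_single]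

theorem stdElt_apply_of_ne (A : Theta n r) (t : TensorMod n r) {k' : Comp n r} (h : k' ≠ ro A) :
    stdElt A t k' = 0 := by
  rw [stdElt_apply]
  exact Finset.sum_eq_zero fun k _ => stdElt_single_apply_of_ne A (fun hc => h hc.2) _

theorem dA_diagonal (m : Fin n → ℕ) : dA (Matrix.diagonal m) = 0 := by
  rw [dA]
  refine Finset.sum_eq_zero fun i _ => Finset.sum_eq_zero fun j _ =>
    Finset.sum_eq_zero fun k _ => Finset.sum_eq_zero fun l _ => ?_
  split_ifs with h
  · rw [Matrix.diagonal_apply, Matrix.diagonal_apply]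
    split_ifs with h1 h2
    · subst h1 h2; omega
    all_goals simp
  · rfl

theorem ro_diagonal {X : Theta n r} {m : Fin n → ℕ} (hX : X.1 = Matrix.diagonal m) :
    (ro X).1 = m := by
  ext i; simp [ro, hX, Matrix.diagonal_apply]

theorem co_diagonal {X : Theta n r} {m : Fin n → ℕ} (hX : X.1 = Matrix.diagonal m) :
    (co X).1 = m := by
  ext i; simp [co, hX, Matrix.diagonal_apply]

/-- For a diagonal matrix, `[A]` is the projection onto one of the summands. -/
theorem stdElt_diagonal_apply {X : Theta n r} {m : Fin n → ℕ} (hX : X.1 = Matrix.diagonal m)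
    (t : TensorMod n r) : stdElt X t (ro X) = t (ro X) := by
  have hrc : co X = ro X := Subtype.ext ((co_diagonal hX).trans (ro_diagonal hX).symm)
  rw [stdElt_apply, Finset.sum_eq_single (ro X)]
  · obtain ⟨h, hh⟩ := exists_xMul (t (ro X))
    obtain ⟨d, hd, hs⟩ := stdElt_spec X
    rw [hrc] at hd hs
    have hy : d ∈ young (ro X) := mem_young_of_relMatrix fun i j hij => by
      rw [hd, hX, Matrix.diagonal_apply_ne _ hij]
    refine Subtype.ext ?_
    rw [hh, hs, if_pos ⟨rfl, rfl⟩, hX, dA_diagonal, dcSum_of_mem_young hy]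
    simp [xMul]
  · exact fun k _ hk => stdElt_single_apply_of_ne X (fun hc => hk (hc.1.trans hrc)) _
  · simp

theorem stdElt_diagonal_mul {X : Theta n r} {m : Fin n → ℕ} (hX : X.1 = Matrix.diagonal m)
    (B : Theta n r) : stdElt X * stdElt B = if m = (ro B).1 then stdElt B else 0 := by
  have hm := ro_diagonal hX
  refine LinearMap.ext fun t => funext fun k' => ?_
  rw [Module.End.mul_apply]
  by_cases hk : k' = ro X
  · subst hk
    rw [stdElt_diagonal_apply hX]
    split_ifs with h
    · rfl
    · refine stdElt_apply_of_ne B t fun hc => h ?_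
      rw [← hm, hc]
  · rw [stdElt_apply_of_ne X _ hk]
    split_ifs with h
    · exact (stdElt_apply_of_ne B t fun hc => hk (Subtype.ext (by rw [hm, hc, h]))).symm
    · rfl

theorem mul_stdElt_diagonal {X : Theta n r} {m : Fin n → ℕ} (hX : X.1 = Matrix.diagonal m)
    (B : Theta n r) : stdElt B * stdElt X = if m = (co B).1 then stdElt B else 0 := by
  have hm := ro_diagonal hX
  refine LinearMap.ext fun t => funext fun k' => ?_
  have hXt : stdElt X t = Pi.single (ro X) (t (ro X)) := by
    funext k
    by_cases hk : k = ro X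
    · subst hk
      rw [stdElt_diagonal_apply hX, Pi.single_eq_same]
    · rw [stdElt_apply_of_ne X _ hk, Pi.single_eq_of_ne hk]
  rw [Module.End.mul_apply, hXt]
  split_ifs with h
  · rw [stdElt_apply B t, Finset.sum_eq_single (ro X)]
    · intro k _ hk
      exact stdElt_single_apply_of_ne B (fun hc => hk (hc.1.trans (Subtype.ext (by rw [hm, h])))) _
    · simp
  · exact stdElt_single_apply_of_ne B (fun hc => h (by rw [← hm, hc.1])) _

/-- The elements `[A]` have dual linear functionals: `[A]` involves the `T_x` with `x` in the
double coset of `A`, and distinct double cosets are disjoint. -/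
theorem exists_dual (A : Theta n r) : ∃ f : QSchur n r →ₗ[Qv] Qv,
    ∀ B, f (stdElt B) = if B = A then 1 else 0 := by
  classical
  obtain ⟨d, hd, hs⟩ := stdElt_spec A
  let f : QSchur n r →ₗ[Qv] Qv :=
    { toFun := fun F => v ^ (dA A.1 : ℤ) * Hecke.coeff d
        ((F (Pi.single (co A) (xMul (co A) 1)) (ro A) : permMod (ro A)) : Hecke r)
      map_add' := fun F G => by
        rw [LinearMap.add_apply, Pi.add_apply, Submodule.coe_add, map_add, mul_add]
      map_smul' := fun c F => by
        rw [LinearMap.smul_apply, Pi.smul_apply, Submodule.coe_smul_of_tower, map_smul,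
          smul_eq_mul, RingHom.id_apply, smul_eq_mul]
        ring }
  have hcoeff : ∀ (l m : Comp n r) (e : Equiv.Perm (Fin r)), Hecke.coeff d (dcSum l m e) =
      if d ∈ DoubleCoset.doubleCoset e (young l : Set (Equiv.Perm (Fin r))) (young m)
        then 1 else 0 := by
    intro l m e
    rw [dcSum, map_sum]
    simp [Hecke.coeff_T, Finset.sum_ite_eq']
  refine ⟨f, fun B => ?_⟩
  change v ^ (dA A.1 : ℤ) * Hecke.coeff d
    ((stdElt B (Pi.single (co A) (xMul (co A) 1)) (ro A) : permMod (ro A)) : Hecke r) = _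
  split_ifs with h
  · subst h
    rw [hs, if_pos ⟨rfl, rfl⟩, mul_one, map_smul, hcoeff,
      if_pos (DoubleCoset.mem_doubleCoset_self _ _ _), smul_eq_mul, mul_one, zpow_neg,
      mul_inv_cancel₀ (zpow_ne_zero _ RatFunc.X_ne_zero)]
  · obtain ⟨e, he, hs'⟩ := stdElt_spec B
    rw [hs']
    split_ifs with hc
    · rw [mul_one, map_smul, hcoeff, if_neg, smul_zero, mul_zero]
      intro hmem
      apply h
      have := relMatrix_eq_of_mem hmem
      rw [he, ← hc.1, ← hc.2, hd] at this
      exact Subtype.ext this.symm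
    · rw [map_zero, mul_zero]

end Schur

/-! ### Gaussian binomials as functions of the upper index -/

section Gaussian

theorem v_ne_zero : v ≠ 0 := RatFunc.X_ne_zero

theorem v_pow_ne_one {k : ℕ} (hk : k ≠ 0) : v ^ k ≠ 1 := by
  have h : v ^ k = algebraMap (Polynomial ℚ) Qv (Polynomial.X ^ k) := by
    rw [map_pow, RatFunc.algebraMap_X, v]
  rw [h, ← map_one (algebraMap (Polynomial ℚ) Qv), (RatFunc.algebraMap_injective ℚ).ne_iff]
  intro hc
  have := congrArg Polynomial.natDegree hc
  rw [Polynomial.natDegree_X_pow, Polynomial.natDegree_one] at this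
  exact hk this

theorem v_zpow_eq_one {k : ℤ} (h : v ^ k = 1) : k = 0 := by
  obtain ⟨m, rfl | rfl⟩ := Int.eq_nat_or_neg k
  · rw [zpow_natCast] at h
    by_contra hm
    exact v_pow_ne_one (by omega) h
  · rw [zpow_neg, inv_eq_one, zpow_natCast] at h
    by_contra hm
    exact v_pow_ne_one (by omega) h

theorem v_zpow_injective : Function.Injective fun k : ℤ => v ^ k := by
  intro a b h
  have h' : v ^ (a - b) = 1 := by
    rw [zpow_sub₀ v_ne_zero, div_eq_one_iff_eq (zpow_ne_zero _ v_ne_zero)]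
    exact h
  have := v_zpow_eq_one h'
  omega

theorem v_sub_inv_ne_zero : v - v⁻¹ ≠ 0 := by
  rw [sub_ne_zero]
  intro h
  have := v_zpow_injective (a₁ := 1) (a₂ := -1) (by simpa using h)
  omega

theorem qint_mul (N : ℤ) : qint N * (v - v⁻¹) = v ^ N - v ^ (-N) :=
  div_mul_cancel₀ _ v_sub_inv_ne_zero

theorem qint_succ_ne_zero (s : ℕ) : qint ((s : ℤ) + 1) ≠ 0 := by
  refine div_ne_zero (sub_ne_zero.2 fun h => ?_) v_sub_inv_ne_zero
  have := v_zpow_injective h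
  omega

@[simp] theorem gbinom_zero (N : ℤ) : gbinom N 0 = 1 := by simp [gbinom]

theorem gbinom_succ_mul (N : ℤ) (t : ℕ) :
    gbinom N (t + 1) * qint ((t : ℤ) + 1) = gbinom N t * qint (N - t) := by
  have h1 := qint_succ_ne_zero t
  have h2 : ∏ s ∈ Finset.range t, qint ((s : ℤ) + 1) ≠ 0 :=
    Finset.prod_ne_zero_iff.2 fun s _ => qint_succ_ne_zero s
  rw [gbinom, gbinom, Finset.prod_range_succ, Finset.prod_range_succ]
  field_simp

theorem gbinom_add_one_mul (N : ℤ) (t : ℕ) :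
    gbinom (N + 1) (t + 1) * qint ((t : ℤ) + 1) = gbinom N t * qint (N + 1) := by
  have h1 := qint_succ_ne_zero t
  have h2 : ∏ s ∈ Finset.range t, qint ((s : ℤ) + 1) ≠ 0 :=
    Finset.prod_ne_zero_iff.2 fun s _ => qint_succ_ne_zero s
  rw [gbinom, gbinom, Finset.prod_range_succ', Finset.prod_range_succ]
  have h3 : ∀ s : ℕ, N + 1 - ((s + 1 : ℕ) : ℤ) = N - s := fun s => by push_cast; ring
  simp only [h3, Nat.cast_zero, sub_zero]
  field_simp

theorem gbinom_pascal (N : ℤ) (t : ℕ) : gbinom (N + 1) (t + 1) =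
    v ^ ((t : ℤ) + 1) * gbinom N (t + 1) + v ^ ((t : ℤ) - N) * gbinom N t := by
  have h : qint (N + 1) = v ^ ((t : ℤ) + 1) * qint (N - t) + v ^ ((t : ℤ) - N) * qint (t + 1) := by
    apply mul_right_cancel₀ v_sub_inv_ne_zero
    rw [add_mul, mul_assoc, mul_assoc, qint_mul, qint_mul, qint_mul, mul_sub, mul_sub]
    simp only [← zpow_add₀ v_ne_zero]
    ring_nf
  apply mul_right_cancel₀ (qint_succ_ne_zero t)
  rw [gbinom_add_one_mul, add_mul, mul_assoc, gbinom_succ_mul, h]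
  ring

/-- The function `N ↦ v^((N + a) d) [N + a; t]` on `ℕ`. -/
def qfun (a : ℕ) (d : ℤ) (t : ℕ) : ℕ → Qv := fun N =>
  v ^ (((N + a : ℕ) : ℤ) * d) * gbinom ((N + a : ℕ) : ℤ) t

/-- The invertible element `v^k` of `𝒵`. -/
def vz (k : ℤ) : Zv := ⟨v ^ k, by
  obtain ⟨m, rfl | rfl⟩ := Int.eq_nat_or_neg k
  · rw [zpow_natCast]
    exact pow_mem (Algebra.subset_adjoin (by simp)) m
  · rw [zpow_neg, zpow_natCast, ← inv_pow]
    exact pow_mem (Algebra.subset_adjoin (by simp)) m⟩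

theorem zpow_smul_mem {M : Type*} [AddCommGroup M] [Module Qv M] {W : Submodule Zv M} {x : M}
    (hx : x ∈ W) (k : ℤ) : v ^ k • x ∈ W := W.smul_mem (vz k) hx

/-- The quadratic relation for `v^N`, as a linear relation between the functions `qfun`. -/
theorem qfun_eq (a : ℕ) (d : ℤ) (t : ℕ) : qfun a d t =
    v ^ (2 * (t : ℤ)) • qfun a (d - 2) t + v ^ (2 * (t : ℤ) + 1) • qfun a (d - 1) (t + 1) -
      v ^ (-1 : ℤ) • qfun a (d - 1) (t + 1) := by
  funext N
  simp only [Pi.add_apply, Pi.sub_apply, Pi.smul_apply, smul_eq_mul, qfun]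
  generalize ((N + a : ℕ) : ℤ) = M
  have h := congrArg (· * (v - v⁻¹)) (gbinom_succ_mul M t)
  simp only [mul_assoc, qint_mul] at h
  have e : v ^ (2 * (t : ℤ) + 1) - v ^ (-1 : ℤ) =
      v ^ (t : ℤ) * (v ^ ((t : ℤ) + 1) - v ^ (-((t : ℤ) + 1))) := by
    rw [mul_sub, ← zpow_add₀ v_ne_zero, ← zpow_add₀ v_ne_zero]
    ring_nf
  have : v ^ (2 * (t : ℤ)) * (v ^ (M * (d - 2)) * gbinom M t) +
        v ^ (2 * (t : ℤ) + 1) * (v ^ (M * (d - 1)) * gbinom M (t + 1)) -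
        v ^ (-1 : ℤ) * (v ^ (M * (d - 1)) * gbinom M (t + 1)) =
      v ^ (2 * (t : ℤ)) * v ^ (M * (d - 2)) * gbinom M t + v ^ (M * (d - 1)) * v ^ (t : ℤ) *
        (gbinom M (t + 1) * (v ^ ((t : ℤ) + 1) - v ^ (-((t : ℤ) + 1)))) := by
    linear_combination v ^ (M * (d - 1)) * gbinom M (t + 1) * e
  rw [this, h, ← zpow_add₀ v_ne_zero, ← zpow_add₀ v_ne_zero, mul_left_comm,
    mul_sub (v ^ (M * (d - 1) + (t : ℤ))), ← zpow_add₀ v_ne_zero, ← zpow_add₀ v_ne_zero]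
  ring_nf

theorem qfun_shift_zero (a : ℕ) (d : ℤ) : qfun (a + 1) d 0 = v ^ d • qfun a d 0 := by
  funext N
  simp only [Pi.smul_apply, smul_eq_mul, qfun, gbinom_zero, mul_one, ← zpow_add₀ v_ne_zero]
  push_cast
  ring_nf

/-- The Pascal rule, as a linear relation between the functions `qfun`. -/
theorem qfun_shift_succ (a : ℕ) (d : ℤ) (t : ℕ) : qfun (a + 1) d (t + 1) =
    v ^ (d + t + 1) • qfun a d (t + 1) + v ^ (d + t) • qfun a (d - 1) t := by
  funext N
  simp only [Pi.smul_apply, Pi.add_apply, smul_eq_mul, qfun]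
  have h : ((N + (a + 1) : ℕ) : ℤ) = ((N + a : ℕ) : ℤ) + 1 := by push_cast; ring
  rw [h]
  generalize ((N + a : ℕ) : ℤ) = M
  rw [gbinom_pascal, mul_add, ← mul_assoc, ← mul_assoc, ← mul_assoc, ← mul_assoc,
    ← zpow_add₀ v_ne_zero, ← zpow_add₀ v_ne_zero, ← zpow_add₀ v_ne_zero, ← zpow_add₀ v_ne_zero]
  ring_nf

/-- The `𝒵`-span of all `N ↦ v^((N + a) d) [N + a; t]`, `d ∈ ℤ`. -/
def qspan (a : ℕ) : Submodule Zv (ℕ → Qv) :=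
  Submodule.span Zv (Set.range fun k : ℤ × ℕ => qfun a k.1 k.2)

theorem qfun_mem_qspan (a : ℕ) (d : ℤ) (t : ℕ) : qfun a d t ∈ qspan a :=
  Submodule.subset_span ⟨(d, t), rfl⟩

/-- The span is invariant under shifts of the argument, in both directions as the coefficient of
`qfun a d (t + 1)` in `qfun_shift_succ` is invertible in `𝒵`. -/
theorem qspan_succ (a : ℕ) : qspan (a + 1) = qspan a := by
  apply le_antisymm
  · refine Submodule.span_le.2 ?_
    rintro _ ⟨⟨d, _ | t⟩, rfl⟩
    · change qfun _ _ _ ∈ _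
      rw [qfun_shift_zero]
      exact zpow_smul_mem (qfun_mem_qspan _ _ _) _
    · change qfun _ _ _ ∈ _
      rw [qfun_shift_succ]
      exact add_mem (zpow_smul_mem (qfun_mem_qspan _ _ _) _)
        (zpow_smul_mem (qfun_mem_qspan _ _ _) _)
  · have cancel : ∀ (k : ℤ) (x : ℕ → Qv), v ^ k • x ∈ qspan (a + 1) → x ∈ qspan (a + 1) := by
      intro k x hx
      have := zpow_smul_mem hx (-k)
      rwa [smul_smul, ← zpow_add₀ v_ne_zero, neg_add_cancel, zpow_zero, one_smul] at this
    have key : ∀ (t : ℕ) (d : ℤ), qfun a d t ∈ qspan (a + 1) := by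
      intro t
      induction t with
      | zero =>
        intro d
        apply cancel d
        rw [← qfun_shift_zero]
        exact qfun_mem_qspan _ _ _
      | succ t ih =>
        intro d
        apply cancel (d + t + 1)
        rw [← add_sub_cancel_right (v ^ (d + t + 1) • qfun a d (t + 1))
          (v ^ (d + t) • qfun a (d - 1) t), ← qfun_shift_succ]
        exact sub_mem (qfun_mem_qspan _ _ _) (zpow_smul_mem (ih _) _)
    refine Submodule.span_le.2 ?_
    rintro _ ⟨⟨d, t⟩, rfl⟩
    exact key t d

theorem qspan_eq (a : ℕ) : qspan a = qspan 0 := by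
  induction a with
  | zero => rfl
  | succ a ih => rw [qspan_succ, ih]

/-- The exponents `0` and `1`. -/
abbrev ZeroOne : Type := {d : ℕ // d = 0 ∨ d = 1}

/-- The functions `qfun` with `d ∈ {0, 1}` span all of them. -/
theorem span_qfun_zeroOne (a : ℕ) :
    Submodule.span Zv (Set.range fun k : ZeroOne × ℕ => qfun a (k.1.1 : ℤ) k.2) = qspan 0 := by
  rw [← qspan_eq a]
  set W := Submodule.span Zv (Set.range fun k : ZeroOne × ℕ => qfun a (k.1.1 : ℤ) k.2) with hW
  have h0 : ∀ t, qfun a 0 t ∈ W := fun t => Submodule.subset_span ⟨(⟨0, .inl rfl⟩, t), rfl⟩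
  have h1 : ∀ t, qfun a 1 t ∈ W := fun t => Submodule.subset_span ⟨(⟨1, .inr rfl⟩, t), rfl⟩
  -- The relation `qfun_eq` between the exponents `d`, `d - 1`, `d - 2` is solved for `d` here, and
  -- for `d - 2` in `down`.
  have up : ∀ d, (∀ t, qfun a (d - 2) t ∈ W) → (∀ t, qfun a (d - 1) t ∈ W) →
      ∀ t, qfun a d t ∈ W := by
    intro d h2 h1 t
    rw [qfun_eq]
    exact sub_mem (add_mem (zpow_smul_mem (h2 _) _) (zpow_smul_mem (h1 _) _))
      (zpow_smul_mem (h1 _) _)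
  have down : ∀ d, (∀ t, qfun a d t ∈ W) → (∀ t, qfun a (d - 1) t ∈ W) →
      ∀ t, qfun a (d - 2) t ∈ W := by
    intro d h2 h1 t
    have e : v ^ (2 * (t : ℤ)) • qfun a (d - 2) t = qfun a d t -
        v ^ (2 * (t : ℤ) + 1) • qfun a (d - 1) (t + 1) +
        v ^ (-1 : ℤ) • qfun a (d - 1) (t + 1) := by
      rw [qfun_eq a d t]; abel
    have h : v ^ (2 * (t : ℤ)) • qfun a (d - 2) t ∈ W := by
      rw [e]
      exact add_mem (sub_mem (h2 _) (zpow_smul_mem (h1 _) _)) (zpow_smul_mem (h1 _) _)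
    have := zpow_smul_mem h (-(2 * (t : ℤ)))
    rwa [smul_smul, ← zpow_add₀ v_ne_zero, neg_add_cancel, zpow_zero, one_smul] at this
  have all : ∀ d : ℤ, (∀ t, qfun a d t ∈ W) ∧ ∀ t, qfun a (d + 1) t ∈ W := by
    intro d
    induction d using Int.induction_on with
    | zero => exact ⟨h0, by simpa using h1⟩
    | succ i ih =>
      refine ⟨ih.2, up _ ?_ ?_⟩
      · convert ih.1 using 3; ring
      · convert ih.2 using 3; ring
    | pred i ih =>
      refine ⟨?_, ?_⟩
      · have := down (-(i : ℤ) + 1) ih.2 (by convert ih.1 using 3; ring)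
        convert this using 3; ring
      · convert ih.1 using 3; ring
  apply le_antisymm
  · refine Submodule.span_le.2 ?_
    rintro _ ⟨k, rfl⟩
    exact qfun_mem_qspan _ _ _
  · refine Submodule.span_le.2 ?_
    rintro _ ⟨⟨d, t⟩, rfl⟩
    exact (all d).1 t

end Gaussian

/-! ### Linear independence of the functions of one variable -/

section Independence

/-- The function `N ↦ v^(j N)`. -/
def expFun (j : ℤ) : ℕ → Qv := fun N => v ^ (j * (N : ℤ))

theorem linearIndependent_expFun : LinearIndependent Qv expFun := by
  let χ : ℤ → (Multiplicative ℕ →* Qv) := fun j =>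
    { toFun := fun N => v ^ (j * ((N.toAdd : ℕ) : ℤ))
      map_one' := by simp
      map_mul' := fun x y => by
        rw [← zpow_add₀ v_ne_zero, toAdd_mul]; push_cast; ring_nf }
  have hχ : Function.Injective χ := fun i j h => by
    have := DFunLike.congr_fun h (Multiplicative.ofAdd 1)
    exact v_zpow_injective (by simpa [χ] using this)
  exact (linearIndependent_monoidHom (Multiplicative ℕ) Qv).comp χ hχ

/-- A family that is triangular with respect to a linearly independent one, with non-zero
diagonal, is linearly independent. -/
theorem linearIndependent_of_triangular {K M : Type*} [Field K] [AddCommGroup M] [Module K M]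
    {g h : ℕ → M} (hh : LinearIndependent K h)
    (hg : ∀ m, ∃ c : K, c ≠ 0 ∧ g m - c • h m ∈ Submodule.span K (h '' Set.Iio m)) :
    LinearIndependent K g := by
  have hmem : ∀ k m, k < m → g k ∈ Submodule.span K (h '' Set.Iio m) := by
    intro k m hkm
    obtain ⟨c, -, hc⟩ := hg k
    rw [← sub_add_cancel (g k) (c • h k)]
    exact add_mem (Submodule.span_mono (Set.image_mono (Set.Iio_subset_Iio hkm.le)) hc)
      (Submodule.smul_mem _ _ (Submodule.subset_span ⟨k, hkm, rfl⟩))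
  classical
  rw [linearIndependent_iff']
  intro s f hf
  by_contra! hne
  obtain ⟨i, his, hi⟩ := hne
  have hS : (s.filter (f · ≠ 0)).Nonempty := ⟨i, Finset.mem_filter.2 ⟨his, hi⟩⟩
  set m := (s.filter (f · ≠ 0)).max' hS with hm
  obtain ⟨hms, hfm⟩ := Finset.mem_filter.1 ((s.filter (f · ≠ 0)).max'_mem hS)
  rw [← hm] at hms hfm
  have hrest : ∑ k ∈ s.erase m, f k • g k ∈ Submodule.span K (h '' Set.Iio m) := by
    refine Submodule.sum_mem _ fun k hk => ?_
    obtain ⟨hkm, hks⟩ := Finset.mem_erase.1 hk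
    by_cases hfk : f k = 0
    · rw [hfk, zero_smul]; exact zero_mem _
    · have : k ≤ m := Finset.le_max' _ _ (Finset.mem_filter.2 ⟨hks, hfk⟩)
      exact Submodule.smul_mem _ _ (hmem k m (lt_of_le_of_ne this hkm))
  rw [← Finset.add_sum_erase _ _ hms] at hf
  have hgm : g m ∈ Submodule.span K (h '' Set.Iio m) := by
    rw [← Submodule.smul_mem_iff _ hfm, eq_neg_of_add_eq_zero_left hf]
    exact neg_mem hrest
  obtain ⟨c, hc, hcm⟩ := hg m
  apply hh.notMem_span_image (s := Set.Iio m) (x := m) (lt_irrefl m)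
  rw [← Submodule.smul_mem_iff _ hc, ← sub_sub_cancel (g m) (c • h m)]
  exact sub_mem hgm hcm

/-- The span of the functions `N ↦ v^(j N)` with `j` in a set. -/
def expSpan (s : Set ℤ) : Submodule Qv (ℕ → Qv) := Submodule.span Qv (expFun '' s)

theorem expFun_mem {s : Set ℤ} {j : ℤ} (h : j ∈ s) : expFun j ∈ expSpan s :=
  Submodule.subset_span ⟨j, h, rfl⟩

theorem expSpan_mono {s t : Set ℤ} (h : s ⊆ t) : expSpan s ≤ expSpan t :=
  Submodule.span_mono (Set.image_mono h)

theorem expFun_mul_expFun (i j : ℤ) : expFun i * expFun j = expFun (i + j) := by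
  funext N
  simp only [Pi.mul_apply, expFun, ← zpow_add₀ v_ne_zero]
  ring_nf

theorem expFun_mul_mem {a b : ℤ} {x : ℕ → Qv} (hx : x ∈ expSpan (Set.Icc a b)) (k a' b' : ℤ)
    (ha : a' ≤ a + k) (hb : b + k ≤ b') : expFun k * x ∈ expSpan (Set.Icc a' b') := by
  induction hx using Submodule.span_induction with
  | mem x hx =>
    obtain ⟨j, hj, rfl⟩ := hx
    rw [expFun_mul_expFun]
    refine expFun_mem ⟨?_, ?_⟩ <;> have := hj.1 <;> have := hj.2 <;> omega
  | zero => rw [mul_zero]; exact zero_mem _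
  | add x y _ _ hx hy => rw [mul_add]; exact add_mem hx hy
  | smul c x _ hx => rw [mul_smul_comm]; exact Submodule.smul_mem _ _ hx

theorem qfun_zero_succ (a t : ℕ) : ∃ α β : Qv, α ≠ 0 ∧ β ≠ 0 ∧
    qfun a 0 (t + 1) = α • (expFun 1 * qfun a 0 t) - β • (expFun (-1) * qfun a 0 t) := by
  set c := qint ((t : ℤ) + 1) * (v - v⁻¹) with hc
  have hc0 : c ≠ 0 := mul_ne_zero (qint_succ_ne_zero t) v_sub_inv_ne_zero
  refine ⟨v ^ ((a : ℤ) - t) / c, v ^ ((t : ℤ) - a) / c,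
    div_ne_zero (zpow_ne_zero _ v_ne_zero) hc0, div_ne_zero (zpow_ne_zero _ v_ne_zero) hc0, ?_⟩
  funext N
  simp only [Pi.sub_apply, Pi.smul_apply, Pi.mul_apply, smul_eq_mul, qfun, expFun, mul_zero,
    zpow_zero, one_mul]
  have h : gbinom ((N + a : ℕ) : ℤ) (t + 1) * c =
      gbinom ((N + a : ℕ) : ℤ) t * (v ^ ((a : ℤ) - t) * v ^ (N : ℤ) -
        v ^ ((t : ℤ) - a) * v ^ (-1 * (N : ℤ))) := by
    rw [hc, ← mul_assoc, gbinom_succ_mul, mul_assoc, qint_mul, ← zpow_add₀ v_ne_zero,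
      ← zpow_add₀ v_ne_zero]
    push_cast
    ring_nf
  rw [eq_div_of_mul_eq hc0 h]
  ring

theorem qfun_one (a t : ℕ) : qfun a 1 t = v ^ (a : ℤ) • (expFun 1 * qfun a 0 t) := by
  funext N
  simp only [Pi.smul_apply, Pi.mul_apply, smul_eq_mul, qfun, expFun, mul_zero, mul_one,
    zpow_zero, one_mul]
  rw [← mul_assoc, ← zpow_add₀ v_ne_zero]
  push_cast
  ring_nf

theorem qfun_zero_zero (a : ℕ) : qfun a 0 0 = expFun 0 := by
  funext N
  simp [qfun, expFun]

/-- The Laurent polynomial in `v^N` that gives `qfun a 0 t` has lowest term of degree `-t` and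
highest term of degree `t`. -/
theorem qfun_zero_mem (a t : ℕ) :
    (∃ c : Qv, c ≠ 0 ∧ qfun a 0 t - c • expFun (-t) ∈ expSpan (Set.Icc (-t + 1) t)) ∧
    (∃ c : Qv, c ≠ 0 ∧ qfun a 0 t - c • expFun t ∈ expSpan (Set.Icc (-t) (t - 1))) := by
  induction t with
  | zero =>
    constructor <;> exact ⟨1, one_ne_zero, by simp [qfun_zero_zero]⟩
  | succ t ih =>
    obtain ⟨⟨c, hc, h⟩, c', hc', h'⟩ := ih
    obtain ⟨α, β, hα, hβ, e⟩ := qfun_zero_succ a t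
    have hfull : qfun a 0 t ∈ expSpan (Set.Icc (-t) t) := by
      rw [← sub_add_cancel (qfun a 0 t) (c • expFun (-t))]
      exact add_mem (expSpan_mono (Set.Icc_subset_Icc (by omega) le_rfl) h)
        (Submodule.smul_mem _ _ (expFun_mem ⟨le_rfl, by omega⟩))
    constructor
    · refine ⟨-(β * c), neg_ne_zero.2 (mul_ne_zero hβ hc), ?_⟩
      have : qfun a 0 (t + 1) - -(β * c) • expFun (-((t + 1 : ℕ) : ℤ)) =
          α • (expFun 1 * qfun a 0 t) -
            β • (expFun (-1) * (qfun a 0 t - c • expFun (-t))) := by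
        have e' : expFun (-((t + 1 : ℕ) : ℤ)) = expFun (-1) * expFun (-t) := by
          rw [expFun_mul_expFun]; push_cast; ring_nf
        rw [e, e', mul_sub, mul_smul_comm, smul_sub, smul_smul, neg_smul]
        abel
      rw [this]
      exact sub_mem
        (Submodule.smul_mem _ _ (expFun_mul_mem hfull _ _ _ (by omega) (by omega)))
        (Submodule.smul_mem _ _ (expFun_mul_mem h _ _ _ (by omega) (by omega)))
    · refine ⟨α * c', mul_ne_zero hα hc', ?_⟩
      have : qfun a 0 (t + 1) - (α * c') • expFun ((t + 1 : ℕ) : ℤ) =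
          α • (expFun 1 * (qfun a 0 t - c' • expFun t)) -
            β • (expFun (-1) * qfun a 0 t) := by
        have e' : expFun ((t + 1 : ℕ) : ℤ) = expFun 1 * expFun t := by
          rw [expFun_mul_expFun]; push_cast; ring_nf
        rw [e, e', mul_sub, mul_smul_comm, smul_sub, smul_smul]
        abel
      rw [this]
      exact sub_mem
        (Submodule.smul_mem _ _ (expFun_mul_mem h' _ _ _ (by omega) (by omega)))
        (Submodule.smul_mem _ _ (expFun_mul_mem hfull _ _ _ (by omega) (by omega)))

/-- The enumeration `0, 1, -1, 2, -2, …` of the integers. -/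
def zigzag (m : ℕ) : ℤ := if m % 2 = 0 then -((m / 2 : ℕ) : ℤ) else ((m / 2 : ℕ) : ℤ) + 1

theorem zigzag_injective : Function.Injective zigzag := by
  intro a b h
  simp only [zigzag] at h
  split_ifs at h <;> omega

theorem Icc_subset_zigzag {a b : ℤ} {m : ℕ} (ha : -(m : ℤ) < 2 * a) (hb : 2 * b ≤ m) :
    Set.Icc a b ⊆ zigzag '' Set.Iio m := by
  rintro j ⟨h1, h2⟩
  rcases le_or_gt j 0 with hj | hj
  · refine ⟨2 * (-j).toNat, ?_, ?_⟩
    · simp only [Set.mem_Iio]; omega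
    · simp only [zigzag]; split_ifs <;> omega
  · refine ⟨2 * (j - 1).toNat + 1, ?_, ?_⟩
    · simp only [Set.mem_Iio]; omega
    · simp only [zigzag]; split_ifs <;> omega

/-- The exponents `-t` and `t + 1` of the extreme terms of `qfun a 0 t` and `qfun a 1 t` are the
terms of `zigzag` with indices `2 t` and `2 t + 1`. -/
theorem linearIndependent_qfun (a : ℕ) :
    LinearIndependent Qv fun k : ZeroOne × ℕ => qfun a (k.1.1 : ℤ) k.2 := by
  have h : LinearIndependent Qv fun m : ℕ => qfun a ((m % 2 : ℕ) : ℤ) (m / 2) := by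
    refine linearIndependent_of_triangular
      (linearIndependent_expFun.comp zigzag zigzag_injective) fun m => ?_
    rw [Set.image_comp]
    change ∃ c : Qv, c ≠ 0 ∧ _ ∈ expSpan _
    obtain ⟨⟨c, hc, h⟩, c', hc', h'⟩ := qfun_zero_mem a (m / 2)
    rcases Nat.mod_two_eq_zero_or_one m with hm | hm
    · refine ⟨c, hc, ?_⟩
      rw [hm, Function.comp_apply, zigzag, if_pos hm]
      exact expSpan_mono (Icc_subset_zigzag (by omega) (by omega)) h
    · refine ⟨v ^ (a : ℤ) * c', mul_ne_zero (zpow_ne_zero _ v_ne_zero) hc', ?_⟩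
      have e : qfun a ((1 : ℕ) : ℤ) (m / 2) -
          (v ^ (a : ℤ) * c') • expFun (((m / 2 : ℕ) : ℤ) + 1) =
          v ^ (a : ℤ) • (expFun 1 * (qfun a 0 (m / 2) - c' • expFun ((m / 2 : ℕ) : ℤ))) := by
        rw [Nat.cast_one, qfun_one, mul_sub, mul_smul_comm, smul_sub, smul_smul,
          expFun_mul_expFun, add_comm (1 : ℤ)]
      rw [hm, Function.comp_apply, zigzag, if_neg (by omega), e]
      refine expSpan_mono (Icc_subset_zigzag ?_ ?_)
        (Submodule.smul_mem _ _ (expFun_mul_mem h' _ (-((m / 2 : ℕ) : ℤ) + 1) ((m / 2 : ℕ) : ℤ)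
          (by omega) (by omega))) <;> omega
  have hinj : Function.Injective fun k : ZeroOne × ℕ => 2 * k.2 + k.1.1 := by
    rintro ⟨⟨d, hd⟩, t⟩ ⟨⟨d', hd'⟩, t'⟩ hk
    simp only at hk
    obtain rfl : t = t' := by omega
    obtain rfl : d = d' := by omega
    rfl
  convert h.comp _ hinj using 2 with k
  obtain ⟨⟨d, hd⟩, t⟩ := k
  have h1 : (2 * t + d) % 2 = d := by omega
  have h2 : (2 * t + d) / 2 = t := by omega
  simp only [Function.comp_apply, h1, h2]

end Independence

/-! ### Products of functions in separate variables -/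

section Products

/-- Products of linearly independent functions in two separate variables are linearly
independent. -/
theorem linearIndependent_mul {F K L S S' : Type*} [Field F] {g : K → S → F} {h : L → S' → F}
    (hg : LinearIndependent F g) (hh : LinearIndependent F h) :
    LinearIndependent F fun (k : K × L) (p : S × S') => g k.1 p.1 * h k.2 p.2 := by
  classical
  rw [linearIndependent_iff''] at hg hh ⊢
  intro s c hc hsum
  have hsum' : ∀ x y, ∑ l ∈ s.image Prod.snd, (∑ k ∈ s.image Prod.fst, c (k, l) * g k x) * h l y =
      0 := by
    intro x y
    have h1 := congrFun hsum (x, y)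
    simp only [Finset.sum_apply, Pi.smul_apply, smul_eq_mul, Pi.zero_apply] at h1
    rw [← h1]
    simp only [Finset.sum_mul]
    rw [← Finset.sum_product_right' (s.image Prod.fst) (s.image Prod.snd)
      (fun k l => c (k, l) * g k x * h l y)]
    symm
    refine Finset.sum_subset_zero_on_sdiff (fun p hp => ?_) (fun p hp => ?_) (fun p _ => ?_)
    · exact Finset.mem_product.2 ⟨Finset.mem_image_of_mem _ hp, Finset.mem_image_of_mem _ hp⟩
    · rw [hc p (Finset.mem_sdiff.1 hp).2, zero_mul, zero_mul]
    · ring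
  rintro ⟨k, l⟩
  refine hg (s.image Prod.fst) (fun k => c (k, l)) (fun k hk => hc _ fun hm => hk ?_) ?_ k
  · exact Finset.mem_image_of_mem Prod.fst hm
  · funext x
    simp only [Finset.sum_apply, Pi.smul_apply, smul_eq_mul, Pi.zero_apply]
    refine hh (s.image Prod.snd) (fun l => ∑ k ∈ s.image Prod.fst, c (k, l) * g k x)
      (fun l hl => Finset.sum_eq_zero fun k _ => ?_) ?_ l
    · rw [hc _ fun hm => hl (Finset.mem_image_of_mem Prod.snd hm), zero_mul]
    · funext y
      simpa only [Finset.sum_apply, Pi.smul_apply, smul_eq_mul, Pi.zero_apply] using hsum' x y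

theorem linearIndependent_prod {F K S : Type*} [Field F] {n : ℕ} {f : Fin n → K → S → F}
    (hf : ∀ i, LinearIndependent F (f i)) :
    LinearIndependent F fun (κ : Fin n → K) (ν : Fin n → S) => ∏ i, f i (κ i) (ν i) := by
  induction n with
  | zero =>
    rw [linearIndependent_subsingleton_index_iff]
    intro κ hc
    simpa using congrFun hc Fin.elim0
  | succ n ih =>
    have h1 := linearIndependent_mul (hf 0) (ih fun i => hf i.succ)
    have h2 := h1.comp (fun κ : Fin (n + 1) → K => (κ 0, Fin.tail κ)) fun κ κ' h => by
      rw [← Fin.cons_self_tail κ, ← Fin.cons_self_tail κ', (Prod.mk.inj h).1, (Prod.mk.inj h).2]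
    refine LinearIndependent.of_comp
      (LinearMap.funLeft F F fun p : S × (Fin n → S) => (Fin.cons p.1 p.2 : Fin (n + 1) → S)) ?_
    convert h2 using 1
    funext κ p
    simp [LinearMap.funLeft_apply, Fin.prod_univ_succ, Fin.tail]

theorem span_range_prod {R F K S : Type*} [CommSemiring R] [CommSemiring F] [Algebra R F] {n : ℕ}
    (f : Fin n → K → S → F) :
    Submodule.span R (Set.range fun (κ : Fin n → K) (ν : Fin n → S) => ∏ i, f i (κ i) (ν i)) =
      ∏ i, (Submodule.span R (Set.range (f i))).map
        (LinearMap.funLeft R F fun ν : Fin n → S => ν i) := by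
  simp only [Submodule.map_span]
  rw [Submodule.prod_span]
  congr 1
  ext x
  rw [Set.mem_fintype_prod]
  constructor
  · rintro ⟨κ, rfl⟩
    refine ⟨fun i ν => f i (κ i) (ν i), fun i => ⟨f i (κ i), ⟨κ i, rfl⟩, rfl⟩, ?_⟩
    funext ν
    simp
  · rintro ⟨g, hg, rfl⟩
    choose y hy hy' using hg
    choose κ hκ using hy
    refine ⟨κ, ?_⟩
    funext ν
    simp only [Finset.prod_apply]
    refine Finset.prod_congr rfl fun i _ => ?_
    rw [← hy', ← hκ]
    rfl

variable {n : ℕ}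

/-- The function `ν ↦ ∏ᵢ v^((νᵢ + aᵢ) dᵢ) [νᵢ + aᵢ; lᵢ]` on `ℕⁿ`. -/
def qfunVec (a : Fin n → ℕ) (d : Fin n → ℤ) (l : Fin n → ℕ) : (Fin n → ℕ) → Qv :=
  fun ν => ∏ i, qfun (a i) (d i) (l i) (ν i)

/-- The `𝒵`-span of all `qfunVec 0 d l`. -/
def qspanVec (n : ℕ) : Submodule Zv ((Fin n → ℕ) → Qv) :=
  Submodule.span Zv (Set.range fun p : (Fin n → ℤ) × (Fin n → ℕ) => qfunVec 0 p.1 p.2)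

/-- Families of exponents in `{0, 1}`. -/
abbrev ZeroOneVec (n : ℕ) : Type := {δ : Fin n → ℕ // ∀ i, δ i = 0 ∨ δ i = 1}

/-- Pairs of families as families of pairs. -/
def pairFamily (p : ZeroOneVec n × (Fin n → ℕ)) : Fin n → ZeroOne × ℕ :=
  fun i => (⟨p.1.1 i, p.1.2 i⟩, p.2 i)

theorem pairFamily_injective : Function.Injective (pairFamily (n := n)) := by
  rintro ⟨⟨d, hd⟩, l⟩ ⟨⟨d', hd'⟩, l'⟩ h
  have h1 : d = d' := funext fun i => congrArg (fun q => (q i).1.1) h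
  have h2 : l = l' := funext fun i => congrArg (fun q => (q i).2) h
  subst h1 h2
  rfl

theorem pairFamily_surjective : Function.Surjective (pairFamily (n := n)) :=
  fun κ => ⟨(⟨fun i => (κ i).1.1, fun i => (κ i).1.2⟩, fun i => (κ i).2), rfl⟩

theorem linearIndependent_qfunVec (a : Fin n → ℕ) :
    LinearIndependent Qv fun p : ZeroOneVec n × (Fin n → ℕ) =>
      qfunVec a (fun i => (p.1.1 i : ℤ)) p.2 :=
  (linearIndependent_prod fun i => linearIndependent_qfun (a i)).comp pairFamily
    pairFamily_injective

theorem span_qfunVec_zeroOne (a : Fin n → ℕ) :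
    Submodule.span Zv (Set.range fun p : ZeroOneVec n × (Fin n → ℕ) =>
      qfunVec a (fun i => (p.1.1 i : ℤ)) p.2) = qspanVec n := by
  have h1 : (Set.range fun p : ZeroOneVec n × (Fin n → ℕ) =>
      qfunVec a (fun i => (p.1.1 i : ℤ)) p.2) =
      Set.range fun (κ : Fin n → ZeroOne × ℕ) (ν : Fin n → ℕ) =>
        ∏ i, qfun (a i) ((κ i).1.1 : ℤ) (κ i).2 (ν i) :=
    pairFamily_surjective.range_comp fun (κ : Fin n → ZeroOne × ℕ) (ν : Fin n → ℕ) =>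
        ∏ i, qfun (a i) ((κ i).1.1 : ℤ) (κ i).2 (ν i)
  have h2 : (Set.range fun p : (Fin n → ℤ) × (Fin n → ℕ) => qfunVec 0 p.1 p.2) =
      Set.range fun (κ : Fin n → ℤ × ℕ) (ν : Fin n → ℕ) =>
        ∏ i, qfun 0 (κ i).1 (κ i).2 (ν i) := by
    ext x
    constructor
    · rintro ⟨p, rfl⟩
      exact ⟨fun i => (p.1 i, p.2 i), rfl⟩
    · rintro ⟨κ, rfl⟩
      exact ⟨(fun i => (κ i).1, fun i => (κ i).2), rfl⟩
  rw [qspanVec, h1, h2,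
    span_range_prod (R := Zv) fun (i : Fin n) (k : ZeroOne × ℕ) => qfun (a i) (k.1.1 : ℤ) k.2,
    span_range_prod (R := Zv) fun (_ : Fin n) (k : ℤ × ℕ) => qfun 0 k.1 k.2]
  refine Finset.prod_congr rfl fun i _ => ?_
  rw [span_qfun_zeroOne]
  rfl

theorem qfunVec_apply (a : Fin n → ℕ) (d : Fin n → ℤ) (l : Fin n → ℕ) (ν : Fin n → ℕ) :
    qfunVec a d l ν = v ^ (∑ i, ((ν i + a i : ℕ) : ℤ) * d i) *
      gbinomVec (fun i => ((ν i + a i : ℕ) : ℤ)) l := by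
  have hz : ∀ (s : Finset (Fin n)) (f : Fin n → ℤ), v ^ (∑ i ∈ s, f i) = ∏ i ∈ s, v ^ f i := by
    classical
    intro s f
    induction s using Finset.induction_on with
    | empty => simp
    | insert i s hi ih => rw [Finset.sum_insert hi, Finset.prod_insert hi, zpow_add₀ v_ne_zero, ih]
  rw [hz, gbinomVec, ← Finset.prod_mul_distrib]
  rfl

end Products

/-! ### The series `∑ F(μ) [A + diag μ]` and the bases -/

section Bases

variable {n : ℕ}

/-- The family `(∑_μ F(μ) [A + diag μ])_r`, `μ ∈ Λ(n, r - σ(A))`, attached to a function `F`. -/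
def series (A : OffDiag n) : ((Fin n → ℕ) → Qv) →ₗ[Qv] ((r : ℕ) → QSchur n r) where
  toFun F r := if h : sigma A.1 ≤ r then
    ∑ μ : Comp n (r - sigma A.1),
      F μ.1 • stdElt (⟨A.1 + Matrix.diagonal μ.1, sigma_add_diagonal h μ⟩ : Theta n r)
  else 0
  map_add' F G := by
    funext r
    rw [Pi.add_apply]
    split_ifs
    · simp only [Pi.add_apply, add_smul, Finset.sum_add_distrib]
    · rw [add_zero]
  map_smul' c F := by
    funext r
    rw [Pi.smul_apply]
    split_ifs
    · simp only [Pi.smul_apply, smul_eq_mul, mul_smul, Finset.smul_sum, RingHom.id_apply]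
    · rw [smul_zero]

theorem series_apply (A : OffDiag n) (F : (Fin n → ℕ) → Qv) (r : ℕ) :
    series A F r = if h : sigma A.1 ≤ r then
      ∑ μ : Comp n (r - sigma A.1),
        F μ.1 • stdElt (⟨A.1 + Matrix.diagonal μ.1, sigma_add_diagonal h μ⟩ : Theta n r)
      else 0 := rfl

theorem elt_eq_series (A : OffDiag n) (δ : Fin n → ℤ) (l : Fin n → ℕ) :
    elt A δ l = series A (qfunVec 0 δ l) := by
  funext r
  rw [elt, eltR, series_apply]
  simp only [qfunVec_apply, Pi.zero_apply, add_zero]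

theorem elt₀_zero_eq_series (A : OffDiag n) : elt₀ A 0 = series A 1 := by
  rw [elt₀, elt_eq_series]
  congr 1
  funext ν
  simp [qfunVec_apply, gbinomVec]

theorem ro_add_diagonal {A : OffDiag n} {r : ℕ} {μ : Fin n → ℕ}
    (h : sigma (A.1 + Matrix.diagonal μ) = r) :
    (ro (⟨A.1 + Matrix.diagonal μ, h⟩ : Theta n r)).1 = fun i => μ i + ∑ j, A.1 i j := by
  funext i
  simp [ro, Finset.sum_add_distrib, Matrix.diagonal_apply, add_comm]

theorem co_add_diagonal {A : OffDiag n} {r : ℕ} {μ : Fin n → ℕ}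
    (h : sigma (A.1 + Matrix.diagonal μ) = r) :
    (co (⟨A.1 + Matrix.diagonal μ, h⟩ : Theta n r)).1 = fun j => μ j + ∑ i, A.1 i j := by
  funext j
  simp [co, Finset.sum_add_distrib, Matrix.diagonal_apply, add_comm]

theorem sigma_zeroMat : sigma (zeroMat n).1 = 0 := by simp [sigma, zeroMat]

/-- A series over diagonal matrices acts on the left of a series through row sums. -/
theorem series_zero_mul (A : OffDiag n) (G F : (Fin n → ℕ) → Qv) :
    series (zeroMat n) G * series A F =
      series A fun ν => G (fun i => ν i + ∑ j, A.1 i j) * F ν := by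
  funext r
  rw [Pi.mul_apply, series_apply, series_apply, series_apply,
    dif_pos (by rw [sigma_zeroMat]; exact Nat.zero_le r)]
  split_ifs with h
  · rw [Finset.mul_sum]
    refine Finset.sum_congr rfl fun ν _ => ?_
    have hX : ∀ (μ : Comp n (r - sigma (zeroMat n).1))
        (h' : sigma ((zeroMat n).1 + Matrix.diagonal μ.1) = r),
        stdElt (⟨(zeroMat n).1 + Matrix.diagonal μ.1, h'⟩ : Theta n r) *
          stdElt (⟨A.1 + Matrix.diagonal ν.1, sigma_add_diagonal h ν⟩ : Theta n r) =
          if μ.1 = fun i => ν.1 i + ∑ j, A.1 i j then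
            stdElt ⟨A.1 + Matrix.diagonal ν.1, sigma_add_diagonal h ν⟩
          else 0 := fun μ h' => by
      rw [stdElt_diagonal_mul (m := μ.1) (zero_add _), ro_add_diagonal]
    rw [Finset.sum_mul]
    simp only [smul_mul_assoc, mul_smul_comm, hX]
    have hmem : ∑ i, (ν.1 i + ∑ j, A.1 i j) = r - sigma (zeroMat n).1 := by
      rw [Finset.sum_add_distrib, ν.2, sigma_zeroMat]
      change r - sigma A.1 + sigma A.1 = _
      omega
    rw [Finset.sum_eq_single ⟨fun i => ν.1 i + ∑ j, A.1 i j, hmem⟩]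
    · rw [if_pos rfl, smul_smul, mul_comm]
    · intro μ _ hμ
      rw [if_neg fun hc => hμ (Subtype.ext hc), smul_zero, smul_zero]
    · simp
  · rw [mul_zero]

/-- A series over diagonal matrices acts on the right of a series through column sums. -/
theorem series_mul_zero (A : OffDiag n) (G F : (Fin n → ℕ) → Qv) :
    series A F * series (zeroMat n) G =
      series A fun ν => G (fun j => ν j + ∑ i, A.1 i j) * F ν := by
  funext r
  rw [Pi.mul_apply, series_apply, series_apply, series_apply,
    dif_pos (c := sigma (zeroMat n).1 ≤ r) (by rw [sigma_zeroMat]; exact Nat.zero_le r)]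
  split_ifs with h
  · rw [Finset.sum_mul]
    refine Finset.sum_congr rfl fun ν _ => ?_
    have hX : ∀ (μ : Comp n (r - sigma (zeroMat n).1))
        (h' : sigma ((zeroMat n).1 + Matrix.diagonal μ.1) = r),
        stdElt (⟨A.1 + Matrix.diagonal ν.1, sigma_add_diagonal h ν⟩ : Theta n r) *
          stdElt (⟨(zeroMat n).1 + Matrix.diagonal μ.1, h'⟩ : Theta n r) =
          if μ.1 = fun j => ν.1 j + ∑ i, A.1 i j then
            stdElt ⟨A.1 + Matrix.diagonal ν.1, sigma_add_diagonal h ν⟩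
          else 0 := fun μ h' => by
      rw [mul_stdElt_diagonal (m := μ.1) (zero_add _), co_add_diagonal]
    rw [Finset.mul_sum]
    simp only [smul_mul_assoc, mul_smul_comm, hX]
    have hmem : ∑ j, (ν.1 j + ∑ i, A.1 i j) = r - sigma (zeroMat n).1 := by
      rw [Finset.sum_add_distrib, ν.2, sigma_zeroMat, Finset.sum_comm]
      change r - sigma A.1 + sigma A.1 = _
      omega
    rw [Finset.sum_eq_single ⟨fun j => ν.1 j + ∑ i, A.1 i j, hmem⟩]
    · rw [if_pos rfl, smul_smul, mul_comm]
    · intro μ _ hμ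
      rw [if_neg fun hc => hμ (Subtype.ext hc), smul_zero, smul_zero]
    · simp
  · rw [zero_mul]

theorem qfunVec_add (a : Fin n → ℕ) (d : Fin n → ℤ) (l : Fin n → ℕ) (ν : Fin n → ℕ) :
    qfunVec 0 d l (fun i => ν i + a i) = qfunVec a d l ν := by
  simp only [qfunVec_apply, Pi.zero_apply, add_zero]

theorem fam₁_eq_series (t : Index n) : fam₁ t =
    series t.1 (qfunVec (fun i => ∑ j, t.1.1 i j) (fun i => (t.2.1.1 i : ℤ)) t.2.2) := by
  rw [fam₁, elt_eq_series, elt₀_zero_eq_series, series_zero_mul]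
  simp only [qfunVec_add, Pi.one_apply, mul_one]

theorem fam₂_eq_series (t : Index n) : fam₂ t =
    series t.1 (qfunVec (fun j => ∑ i, t.1.1 i j) (fun i => (t.2.1.1 i : ℤ)) t.2.2) := by
  rw [fam₂, elt_eq_series, elt₀_zero_eq_series, series_mul_zero]
  simp only [qfunVec_add, Pi.one_apply, mul_one]

theorem fam₃_eq_series (t : Index n) : fam₃ t =
    series t.1 (qfunVec 0 (fun i => (t.2.1.1 i : ℤ)) t.2.2) := elt_eq_series _ _ _

theorem add_diagonal_inj {A B : OffDiag n} {μ ν : Fin n → ℕ}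
    (h : A.1 + Matrix.diagonal μ = B.1 + Matrix.diagonal ν) : A = B ∧ μ = ν := by
  have hij := fun i j => congrFun (congrFun h i) j
  constructor
  · ext i j
    by_cases hne : i = j
    · subst hne; rw [A.2, B.2]
    · simpa [Matrix.diagonal_apply_ne _ hne] using hij i j
  · funext i
    simpa [A.2, B.2] using hij i i

open Classical in
/-- The coefficients of the `[A + diag μ]` in a family can be read off linearly. -/
theorem exists_coefficients (n : ℕ) :
    ∃ Φ : ((r : ℕ) → QSchur n r) →ₗ[Qv] (OffDiag n → (Fin n → ℕ) → Qv),
      ∀ A F, Φ (series A F) = Pi.single A F := by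
  choose f hf using fun (r : ℕ) (A : Theta n r) => exists_dual A
  refine ⟨LinearMap.pi fun B => LinearMap.pi fun ν =>
    (f _ ⟨B.1 + Matrix.diagonal ν, rfl⟩).comp (LinearMap.proj _), fun A F => ?_⟩
  funext B ν
  simp only [LinearMap.pi_apply, LinearMap.comp_apply, LinearMap.proj_apply]
  set r := sigma (B.1 + Matrix.diagonal ν) with hr
  rw [series_apply]
  by_cases hAB : B = A
  · subst hAB
    have hσ : sigma (B.1 + Matrix.diagonal ν) = sigma B.1 + ∑ i, ν i := by
      simp [sigma, Finset.sum_add_distrib, Matrix.diagonal_apply]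
    rw [Pi.single_eq_same, dif_pos (by omega), map_sum]
    rw [Finset.sum_eq_single ⟨ν, by omega⟩]
    · rw [map_smul, hf, if_pos rfl, smul_eq_mul, mul_one]
    · intro μ _ hμ
      rw [map_smul, hf, if_neg, smul_zero]
      exact fun hc => hμ (Subtype.ext (add_diagonal_inj (congrArg Subtype.val hc)).2)
    · simp
  · rw [Pi.single_eq_of_ne hAB]
    split_ifs with h
    · rw [map_sum]
      refine Finset.sum_eq_zero fun μ _ => ?_
      rw [map_smul, hf, if_neg, smul_zero]
      exact fun hc => hAB (add_diagonal_inj (congrArg Subtype.val hc)).1.symm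
    · rw [map_zero]; rfl

/-- Bases of `V(n)` arise from bases of the module of coefficient functions. -/
theorem isBasisOf_series (a : OffDiag n → Fin n → ℕ) :
    IsBasisOf (fun t : Index n => series t.1 (qfunVec (a t.1) (fun i => (t.2.1.1 i : ℤ)) t.2.2))
      (V n) := by
  classical
  constructor
  · obtain ⟨Φ, hΦ⟩ := exists_coefficients n
    have h1 := Pi.linearIndependent_single (R := Qv)
      (fun (A : OffDiag n) (p : ZeroOneVec n × (Fin n → ℕ)) =>
        qfunVec (a A) (fun i => (p.1.1 i : ℤ)) p.2) fun A => linearIndependent_qfunVec (a A)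
    have h2 := h1.comp (Equiv.sigmaEquivProd _ _).symm (Equiv.injective _)
    have h3 : LinearIndependent Qv fun t : Index n =>
        series t.1 (qfunVec (a t.1) (fun i => (t.2.1.1 i : ℤ)) t.2.2) := by
      refine LinearIndependent.of_comp Φ ?_
      rw [show Φ ∘ _ = _ from funext fun t => hΦ _ _]
      exact h2
    exact h3.restrict_scalars' Zv
  · have key : ∀ (b : Fin n → ℕ) (A : OffDiag n),
        Submodule.span Zv (Set.range fun p : ZeroOneVec n × (Fin n → ℕ) =>
          series A (qfunVec b (fun i => (p.1.1 i : ℤ)) p.2)) =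
        (qspanVec n).map ((series A).restrictScalars Zv) := by
      intro b A
      rw [← span_qfunVec_zeroOne b, Submodule.map_span, ← Set.range_comp]
      rfl
    have key' : ∀ A : OffDiag n, (qspanVec n).map ((series A).restrictScalars Zv) =
        Submodule.span Zv (Set.range fun p : (Fin n → ℤ) × (Fin n → ℕ) => elt A p.1 p.2) := by
      intro A
      rw [qspanVec, Submodule.map_span, ← Set.range_comp]
      congr 2
      funext p
      exact (elt_eq_series _ _ _).symm
    apply le_antisymm
    · refine Submodule.span_le.2 ?_
      rintro _ ⟨⟨A, p⟩, rfl⟩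
      have h : series A (qfunVec (a A) (fun i => (p.1.1 i : ℤ)) p.2) ∈
          (qspanVec n).map ((series A).restrictScalars Zv) := by
        rw [← key (a A) A]
        exact Submodule.subset_span ⟨p, rfl⟩
      rw [key'] at h
      refine Submodule.span_mono ?_ h
      rintro _ ⟨q, rfl⟩
      exact ⟨A, q.1, q.2, rfl⟩
    · refine Submodule.span_le.2 ?_
      rintro _ ⟨A, δ, l, rfl⟩
      have h : elt A δ l ∈ (qspanVec n).map ((series A).restrictScalars Zv) := by
        rw [key']
        exact Submodule.subset_span ⟨(δ, l), rfl⟩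
      rw [← key (a A) A] at h
      refine Submodule.span_mono ?_ h
      rintro _ ⟨q, rfl⟩
      exact ⟨(A, q), rfl⟩

end Bases

end BLM

end

theorem lemma4p2 (n : ℕ) :
    BLM.IsBasisOf (BLM.fam₁ (n := n)) (BLM.V n) ∧
    BLM.IsBasisOf (BLM.fam₂ (n := n)) (BLM.V n) ∧
    BLM.IsBasisOf (BLM.fam₃ (n := n)) (BLM.V n) := by
  refine ⟨?_, ?_, ?_⟩
  · rw [funext BLM.fam₁_eq_series]
    exact BLM.isBasisOf_series fun A i => ∑ j, A.1 i j
  · rw [funext BLM.fam₂_eq_series]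
    exact BLM.isBasisOf_series fun A j => ∑ i, A.1 i j
  · rw [funext BLM.fam₃_eq_series]
    exact BLM.isBasisOf_series fun _ => 0
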